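/- Fix an integer $k\ge 0$, rates $\lambda_s,\lambda_e>0$ and $\alpha\in(0,1]$. For $m\ge 1$ consider the following gossip network with a source and $m$ receiver nodes (a scalable homogeneous network). The source generates versions $\ell=1,2,\dots$ at the event times $\tau_1<\tau_2<\cdots$ of a Poisson process $N_0(t)$ of rate $\lambda_s$, and each ordered pair $(i,j)$ of distinct receiver nodes is an edge that is activated at the event times of a Poisson process of rate $\lambda_e/(m-1)$; all these Poisson processes are mutually independent. A fixed set $\mathcal S$ of $n=\lfloor \alpha m\rfloor$ receiver nodes are subscribers (total key subscription): at time $\tau_\ell$ the source splits version $\ell$ into $n$ distinct keys, any $k+1$ of which suffice (and are needed) to decrypt it, and instantaneously sends one of these keys to each subscriber, and none to the other nodes. Nodes have memory: whenever the edge $(i,j)$ is activated, node $i$ sends to node $j$ all keys which it has received from the source since the previous activation of that edge; keys received from other receiver nodes are never passed on. Let $N_j^k(t)$ be the latest version that node $j$ can decrypt at time $t$ (with $N_j^k(t)=0$ if there is none), and let $A_j(k,t)=N_0(t)-N_j^k(t)$ be its $k$-keys version age. Then, whenever $n=\lfloor\alpha m\rfloor\ge k+1$, the limits $$\Delta_j(k)=\lim_{t\to\infty}\frac1t\int_0^t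 A_j(k,u)\,du$$ exist with probability one for every receiver node $j$, and are deterministic constants that depend only on $k,n,m,\lambda_s,\lambda_e$ and on whether $j\in\mathcal S$ (with value $\Delta$, say) or $j\notin\mathcal S$ (with value $\Delta^\dagger$). The graph-average $k$-keys version age $$\Delta^{(m)}:=\frac{n}{m}\,\Delta+\frac{m-n}{m}\,\Delta^\dagger ,\qquad n=\lfloor\alpha m\rfloor,$$ (where the second term is absent if $n=m$) converges as $m\to\infty$, and $$\lim_{m\to\infty}\Delta^{(m)}=\frac{\lambda_s\,(k+1-\alpha)}{\alpha\,\lambda_e}.$$ -/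

import Mathlib

open MeasureTheory ProbabilityTheory Filter Topology

namespace GossipTSS

/-- The Poisson counters of a fully connected gossip network with receiver nodes `Fin m`:
`none` is the update counter of the source, and `some ⟨(i, j), _⟩` is the activation counter of the
directed edge from node `i` to node `j ≠ i`. -/
abbrev Counter (m : ℕ) : Type := Option {e : Fin m × Fin m // e.1 ≠ e.2}

/-- The rates in a scalable homogeneous network: `lamS` for the source and `lamE / (m - 1)` for every
directed edge between two receiver nodes (there are no such edges if `m ≤ 1`). -/
noncomputable def rate (m : ℕ) (lamS lamE : ℝ) : Counter m → ℝ
  | none => lamS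
  | some _ => lamE / ((m : ℝ) - 1)

/-- A realization, on the probability space `(Ω, P)`, of the clocks of a scalable homogeneous network
on `m` receiver nodes with source rate `lamS` and gossip rate `lamE`. Every counter is a Poisson
process, given through its interarrival times, which are independent and exponentially distributed
with the rate of the counter; the counters are mutually independent. -/
structure Clocks (m : ℕ) (lamS lamE : ℝ) {Ω : Type*} [MeasurableSpace Ω] (P : Measure Ω) where
  /-- `gap c r` is the time between the `r`-th and the `(r+1)`-st event of the counter `c`, where the
  zeroth event stands for the time origin. -/
  gap : Counter m → ℕ → Ω → ℝ
  measurable_gap : ∀ c r, Measurable (gap c r)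
  law_gap : ∀ c r, P.map (gap c r) = expMeasure (rate m lamS lamE c)
  indep_gap : iIndepFun (fun p : Counter m × ℕ => gap p.1 p.2) P

namespace Clocks

variable {m : ℕ} {lamS lamE : ℝ} {Ω : Type*} [MeasurableSpace Ω] {P : Measure Ω}

/-- The time of the `r`-th event (`r ≥ 1`) of the counter `c`; it is `0` for `r = 0`. -/
noncomputable def eventTime (N : Clocks m lamS lamE P) (c : Counter m) (r : ℕ) (ω : Ω) : ℝ :=
  ∑ i ∈ Finset.range r, N.gap c i ω

/-- The time at which the source generates version `l` (with value `0` for `l = 0`). -/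
noncomputable def updateTime (N : Clocks m lamS lamE P) (l : ℕ) (ω : Ω) : ℝ :=
  N.eventTime none l ω

/-- The version at the source at time `t`: the number of updates in `[0, t]`. -/
noncomputable def sourceVersion (N : Clocks m lamS lamE P) (t : ℝ) (ω : Ω) : ℕ :=
  {l : ℕ | 1 ≤ l ∧ N.updateTime l ω ≤ t}.ncard

/-- Memory scheme: at the `r`-th activation (`r ≥ 1`) of the edge from `i` to `j`, node `i` sends to
node `j` those keys which it has received from the source since the `(r-1)`-st activation of that edge
(since time `0` if `r = 1`). `Sends N e l t ω` says that in some activation up to time `t` the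
key of version `l` of the tail of `e` is sent over the edge `e`, provided that this tail is one of the
nodes to which the source sends a key. -/
def Sends (N : Clocks m lamS lamE P) (e : {e : Fin m × Fin m // e.1 ≠ e.2})
    (l : ℕ) (t : ℝ) (ω : Ω) : Prop :=
  ∃ r : ℕ, 1 ≤ r ∧ N.eventTime (some e) r ω ≤ t ∧
    N.eventTime (some e) (r - 1) ω < N.updateTime l ω ∧
    N.updateTime l ω ≤ N.eventTime (some e) r ω

/-- The keys of version `l` held by node `j` at time `t` in the memory scheme with total key
subscription: at the time of each update every subscriber (element of `S`), and no other node,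
receives its own distinct key from the source, so the key of version `l` of the subscriber `i` is
identified with `i`. Node `j` holds its own key (if it is a subscriber) and the keys sent to it
directly by other subscribers; only keys received from the source are passed on. -/
def keys (N : Clocks m lamS lamE P) (S : Finset (Fin m)) (j : Fin m) (l : ℕ) (t : ℝ) (ω : Ω) :
    Set (Fin m) :=
  {i | i ∈ S ∧ ((i = j ∧ N.updateTime l ω ≤ t) ∨ ∃ h : i ≠ j, N.Sends ⟨(i, j), h⟩ l t ω)}

/-- The latest version that node `j` can decrypt at time `t`, where decrypting version `l ≥ 1` requires
`k + 1` of its keys. The value is `0` as long as no version has been decrypted. -/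
noncomputable def nodeVersion (N : Clocks m lamS lamE P) (S : Finset (Fin m)) (k : ℕ) (j : Fin m)
    (t : ℝ) (ω : Ω) : ℕ :=
  sSup {l : ℕ | l = 0 ∨ k + 1 ≤ (N.keys S j l t ω).ncard}

/-- The `k`-keys version age of node `j` at time `t`. -/
noncomputable def age (N : Clocks m lamS lamE P) (S : Finset (Fin m)) (k : ℕ) (j : Fin m)
    (t : ℝ) (ω : Ω) : ℝ :=
  (N.sourceVersion t ω : ℝ) - (N.nodeVersion S k j t ω : ℝ)

/-- With probability one, the time average of the `k`-keys version age process of node `j` is `D`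
(the age being integrable over bounded time intervals). -/
def HasVersionAge (N : Clocks m lamS lamE P) (S : Finset (Fin m)) (k : ℕ) (j : Fin m) (D : ℝ) :
    Prop :=
  ∀ᵐ ω ∂P, (∀ t : ℝ, 0 ≤ t → IntervalIntegrable (fun u => N.age S k j u ω) volume 0 t) ∧
    Tendsto (fun t : ℝ => (1 / t) * ∫ u in (0 : ℝ)..t, N.age S k j u ω) atTop (𝓝 D)

/-- `D` is the average `k`-keys version age over the graph: the subscribers have a common version age
`Dsub`, the nonsubscribers have a common version age `Dnon`, and `D` is their average weighted by the
proportions of subscribers and nonsubscribers among the `m` receiver nodes. (If one of the two classes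
is empty, then its weight is `0`.) -/
def HasGraphAge (N : Clocks m lamS lamE P) (S : Finset (Fin m)) (k : ℕ) (D : ℝ) : Prop :=
  ∃ Dsub Dnon : ℝ,
    (∀ j ∈ S, N.HasVersionAge S k j Dsub) ∧ (∀ j ∉ S, N.HasVersionAge S k j Dnon) ∧
    D = (S.card : ℝ) / (m : ℝ) * Dsub + (Sᶜ.card : ℝ) / (m : ℝ) * Dnon

end Clocks

end GossipTSS

/-! Version `l`, generated at `τ l`, crosses the edge from a subscriber `i` to `j` exactly at the
first activation of that edge at or after `τ l`. Node `j` therefore decrypts it at `D l = τ l + X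
l`, where `X l` is the `K`-th smallest residual waiting time at `τ l` among the edges into `j` from
the other subscribers. Here `K = k` for a subscriber, which owns one key, and `K = k + 1` otherwise.
The times `D l` are nondecreasing in `l` (`add_sojourn_mono`), so the latest decryptable version is
the number of `l ≥ 1` with `D l ≤ t` (`nodeVersion_eq_count`). The age is then the number of
customers in a queue with arrivals `τ l` and departures `D l`.

Little's law on sample paths (`tendsto_average_count_sub_count`) gives the time-average age as
`lamS` times the long-run mean of `X l`. That mean exists by a strong law for variables with
geometrically decaying covariances (`ae_tendsto_average_of_covariance_le`). The decay holds because,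
once every edge has rung after `s`, the residual times at `s + d` are fresh independent
exponentials; the exceptional event costs only `O(exp (-c d))` (`exists_lintegral_sojourn_mul_le`).
Stationarity of Poisson residuals comes from a renewal equation (`map_eq_map_zero_of_cons`).

With `N` edges of rate `r` the mean of `X l` is the sum over `j < K` of `1 / (r (N - j))`
(`lintegral_orderStat`). For `r = lamE / (m - 1)` and `N ~ α m` it tends to `K / (α lamE)`.
Weighting `K = k` by `α` and `K = k + 1` by `1 - α` yields `k + 1 - α` in the numerator. -/

namespace GossipTSS

/-- The number of indices `l ≥ 1` with `a l ≤ t`. -/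
noncomputable def count (a : ℕ → ℝ) (t : ℝ) : ℕ := {l : ℕ | 1 ≤ l ∧ a l ≤ t}.ncard

/-! ### Counting functions of monotone sequences and Little's law. -/

section Counting

variable {a : ℕ → ℝ}

/-- Monotonicity makes the set an initial segment and divergence makes it finite, so `ncard` takes
no junk value. The resulting Galois connection `le_count_iff` is what later arguments use. -/
lemma setOf_le_eq_Icc_count (ha : Monotone a) (hi : Tendsto a atTop atTop) (t : ℝ) :
    {l : ℕ | 1 ≤ l ∧ a l ≤ t} = Set.Icc 1 (count a t) := by
  obtain ⟨n, hn⟩ : ∃ n, {l : ℕ | 1 ≤ l ∧ a l ≤ t} = Set.Icc 1 n := by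
    obtain ⟨N, hN⟩ := (hi.eventually_gt_atTop t).exists
    classical
    have hex : ∃ n, t < a (n + 1) := ⟨N, hN.trans_le (ha (by omega))⟩
    refine ⟨Nat.find hex, ?_⟩
    ext l
    simp only [Set.mem_ofPred_eq, Set.mem_Icc, and_congr_right_iff]
    intro hl
    constructor
    · intro h
      by_contra! hlt
      exact absurd (h.trans_lt ((Nat.find_spec hex).trans_le (ha (by omega)))) (lt_irrefl _)
    · intro h
      have := Nat.find_min hex (m := l - 1) (by omega)
      rw [Nat.sub_add_cancel hl] at this
      exact not_lt.1 this
  have : count a t = n := by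
    rw [count, hn, ← Finset.coe_Icc, Set.ncard_coe_finset]; simp
  rw [this, hn]

lemma le_count_iff (ha : Monotone a) (hi : Tendsto a atTop atTop) {t : ℝ} {l : ℕ} (hl : 1 ≤ l) :
    l ≤ count a t ↔ a l ≤ t := by
  have := Set.ext_iff.1 (setOf_le_eq_Icc_count ha hi t) l
  simp only [Set.mem_ofPred_eq, Set.mem_Icc, hl, true_and] at this
  exact this.symm

lemma count_mono (ha : Monotone a) (hi : Tendsto a atTop atTop) : Monotone (count a) := by
  intro s t hst
  rcases Nat.eq_zero_or_pos (count a s) with h | h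
  · omega
  · exact (le_count_iff ha hi h).2 (((le_count_iff ha hi h).1 le_rfl).trans hst)

lemma tendsto_count (ha : Monotone a) (hi : Tendsto a atTop atTop) :
    Tendsto (count a) atTop atTop := by
  refine tendsto_atTop.2 fun n => ?_
  filter_upwards [eventually_ge_atTop (a (n + 1))] with t ht
  exact (Nat.le_succ n).trans ((le_count_iff ha hi (by omega)).2 ht)

lemma tendsto_atTop_of_tendsto_div {c : ℝ} (hc : 0 < c)
    (h : Tendsto (fun l : ℕ => a l / l) atTop (𝓝 c)) : Tendsto a atTop atTop := by
  have := h.pos_mul_atTop hc tendsto_natCast_atTop_atTop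
  refine this.congr' ?_
  filter_upwards [eventually_gt_atTop 0] with n hn
  have : (n : ℝ) ≠ 0 := by positivity
  field_simp

/-- With `n = count a t`, divide `a n ≤ t < a (n + 1)` by `n` and squeeze. -/
lemma tendsto_count_div (ha : Monotone a) {c : ℝ} (hc : 0 < c)
    (h : Tendsto (fun l : ℕ => a l / l) atTop (𝓝 c)) :
    Tendsto (fun t : ℝ => (count a t : ℝ) / t) atTop (𝓝 c⁻¹) := by
  have hi := tendsto_atTop_of_tendsto_div hc h
  have hcount := tendsto_count ha hi
  have h2 : Tendsto (fun l : ℕ => a (l + 1) / l) atTop (𝓝 c) := by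
    have h3 : Tendsto (fun l : ℕ => ((l : ℝ) + 1) / l) atTop (𝓝 1) := by
      have := tendsto_one_div_atTop_nhds_zero_nat (𝕜 := ℝ)
      have h4 := this.const_add 1
      rw [add_zero] at h4
      refine h4.congr' ?_
      filter_upwards [eventually_gt_atTop 0] with n hn
      have : (n : ℝ) ≠ 0 := by positivity
      field_simp
    have h4 := ((tendsto_add_atTop_iff_nat 1).2 h).mul h3
    rw [mul_one] at h4
    refine h4.congr fun n => ?_
    push_cast
    have : (n : ℝ) + 1 ≠ 0 := by positivity
    field_simp
  have key : Tendsto (fun t : ℝ => t / (count a t : ℝ)) atTop (𝓝 c) := by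
    refine tendsto_of_tendsto_of_tendsto_of_le_of_le' (h.comp hcount) (h2.comp hcount) ?_ ?_
    · filter_upwards [hcount.eventually_ge_atTop 1] with t ht
      exact div_le_div_of_nonneg_right ((le_count_iff ha hi ht).1 le_rfl) (by positivity)
    · filter_upwards with t
      refine div_le_div_of_nonneg_right (le_of_lt ?_) (by positivity)
      by_contra! hle
      have := (le_count_iff ha hi (by omega)).2 hle
      omega
  refine (key.inv₀ hc.ne').congr fun t => ?_
  rw [inv_div]

lemma intervalIntegrable_count (ha : Monotone a) (hi : Tendsto a atTop atTop) (s t : ℝ) :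
    IntervalIntegrable (fun u => (count a u : ℝ)) volume s t :=
  Monotone.intervalIntegrable fun _ _ h => Nat.cast_le.2 (count_mono ha hi h)

/-- On `[0, t]` the count is the sum of the indicators of `[a l, ∞)`, each contributing the length
of `[a l, t]`. -/
lemma integral_count (ha : Monotone a) (hi : Tendsto a atTop atTop) (hpos : ∀ l, 1 ≤ l → 0 < a l)
    {t : ℝ} (ht : 0 ≤ t) :
    ∫ u in (0 : ℝ)..t, (count a u : ℝ) = ∑ l ∈ Finset.Icc 1 (count a t), (t - a l) := by
  have h1 : ∀ u ∈ Set.uIcc 0 t, (count a u : ℝ) =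
      ∑ l ∈ Finset.Icc 1 (count a t), (Set.Ici (a l)).indicator (fun _ => (1 : ℝ)) u := by
    intro u hu
    rw [Set.uIcc_of_le ht] at hu
    have : Finset.Icc 1 (count a u) = (Finset.Icc 1 (count a t)).filter (fun l => a l ≤ u) := by
      ext l
      simp only [Finset.mem_Icc, Finset.mem_filter]
      constructor
      · rintro ⟨h1, h2⟩
        exact ⟨⟨h1, h2.trans (count_mono ha hi hu.2)⟩, (le_count_iff ha hi h1).1 h2⟩
      · rintro ⟨⟨h1, h2⟩, h3⟩
        exact ⟨h1, (le_count_iff ha hi h1).2 h3⟩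
    have h2 : count a u = (Finset.Icc 1 (count a u)).card := by simp
    rw [h2, this, Finset.card_filter]
    push_cast
    refine Finset.sum_congr rfl fun l _ => ?_
    simp [Set.indicator_apply]
  rw [intervalIntegral.integral_congr h1, intervalIntegral.integral_finsetSum]
  · refine Finset.sum_congr rfl fun l hl => ?_
    rw [Finset.mem_Icc] at hl
    have h0 := hpos l hl.1
    have hlt := (le_count_iff ha hi hl.1).1 hl.2
    rw [intervalIntegral.integral_of_le ht, integral_indicator_const _ measurableSet_Ici,
      measureReal_restrict_apply measurableSet_Ici]
    have : Set.Ici (a l) ∩ Set.Ioc 0 t = Set.Icc (a l) t := by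
      ext x
      simp only [Set.mem_inter_iff, Set.mem_Ici, Set.mem_Ioc, Set.mem_Icc]
      constructor
      · rintro ⟨h1, h2, h3⟩; exact ⟨h1, h3⟩
      · rintro ⟨h1, h2⟩; exact ⟨h1, h0.trans_le h1, h2⟩
    rw [this, Real.volume_real_Icc_of_le hlt]
    simp
  · intro l _
    refine Monotone.intervalIntegrable fun x y hxy => ?_
    simp only [Set.indicator_apply, Set.mem_Ici]
    split_ifs with h1 h2 <;> norm_num
    exact absurd (h1.trans hxy) h2

end Counting

/-- A term is the difference of two consecutive partial sums. In Little's law this shows that a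
single sojourn is `o(l)`, so departures have the same rate as arrivals. -/
lemma tendsto_div_zero_of_cesaro {x : ℕ → ℝ} {c : ℝ}
    (h : Tendsto (fun n : ℕ => (∑ i ∈ Finset.range n, x i) / n) atTop (𝓝 c)) :
    Tendsto (fun n : ℕ => x n / (n + 1)) atTop (𝓝 0) := by
  have h1 := (tendsto_add_atTop_iff_nat 1).2 h
  have h3 : Tendsto (fun n : ℕ => (n : ℝ) / (n + 1)) atTop (𝓝 1) :=
    tendsto_natCast_div_add_atTop 1
  have h4 := h1.sub (h.mul h3)
  rw [mul_one, sub_self] at h4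
  refine h4.congr' ?_
  filter_upwards [eventually_gt_atTop 0] with n hn
  rw [Finset.sum_range_succ]
  push_cast
  have : (n : ℝ) ≠ 0 := by positivity
  field_simp
  ring

/-- Little's law for a system with arrival times `τ l` and departure times `D l`, `l ≥ 1`: the time
average of the number of customers is the arrival rate times the mean sojourn time. -/
theorem tendsto_average_count_sub_count {τ D : ℕ → ℝ} (hτ : Monotone τ) (hD : Monotone D)
    (hτD : ∀ l, τ l ≤ D l) (hpos : ∀ l, 1 ≤ l → 0 < τ l) {c x : ℝ} (hc : 0 < c)
    (hτc : Tendsto (fun l : ℕ => τ l / l) atTop (𝓝 c))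
    (hx : Tendsto (fun n : ℕ => (∑ i ∈ Finset.range n, (D (i + 1) - τ (i + 1))) / n) atTop (𝓝 x)) :
    (∀ t : ℝ, IntervalIntegrable (fun u => (count τ u : ℝ) - (count D u : ℝ)) volume 0 t) ∧
    Tendsto (fun t : ℝ => (1 / t) * ∫ u in (0 : ℝ)..t, ((count τ u : ℝ) - (count D u : ℝ)))
      atTop (𝓝 (x * c⁻¹)) := by
  have hDc : Tendsto (fun l : ℕ => D l / l) atTop (𝓝 c) := by
    refine (tendsto_add_atTop_iff_nat 1).1 ?_
    have := ((tendsto_add_atTop_iff_nat 1).2 hτc).add (tendsto_div_zero_of_cesaro hx)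
    rw [add_zero] at this
    refine this.congr fun n => ?_
    push_cast
    rw [← add_div]
    congr 1
    ring
  have hτi := tendsto_atTop_of_tendsto_div hc hτc
  have hDi := tendsto_atTop_of_tendsto_div hc hDc
  refine ⟨fun t => (intervalIntegrable_count hτ hτi _ _).sub (intervalIntegrable_count hD hDi _ _),
    ?_⟩
  have hS : ∀ n : ℕ, ∑ i ∈ Finset.range n, (D (i + 1) - τ (i + 1)) =
      ∑ l ∈ Finset.Icc 1 n, (D l - τ l) := by
    intro n
    rw [Finset.range_eq_Ico, Finset.sum_Ico_add' (fun l => D l - τ l) 0 n 1]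
    rfl
  have hint : ∀ t : ℝ, 0 ≤ t → ∫ u in (0 : ℝ)..t, ((count τ u : ℝ) - (count D u : ℝ)) =
      ∑ l ∈ Finset.Icc 1 (count τ t), (t - τ l) - ∑ l ∈ Finset.Icc 1 (count D t), (t - D l) := by
    intro t ht
    rw [intervalIntegral.integral_sub (intervalIntegrable_count hτ hτi _ _)
      (intervalIntegrable_count hD hDi _ _), integral_count hτ hτi hpos ht,
      integral_count hD hDi (fun l hl => (hpos l hl).trans_le (hτD l)) ht]
  have hle : ∀ t, count D t ≤ count τ t := by
    intro t
    rcases Nat.eq_zero_or_pos (count D t) with h | h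
    · omega
    · exact (le_count_iff hτ hτi h).2 ((hτD _).trans ((le_count_iff hD hDi h).1 le_rfl))
  have hsub : ∀ t, Finset.Icc 1 (count D t) ⊆ Finset.Icc 1 (count τ t) := fun t =>
    Finset.Icc_subset_Icc_right (hle t)
  have hlim : ∀ {a : ℕ → ℝ}, Monotone a → Tendsto (fun l : ℕ => a l / l) atTop (𝓝 c) →
      Tendsto (fun t : ℝ => (1 / t) * ∑ l ∈ Finset.Icc 1 (count a t), (D l - τ l))
        atTop (𝓝 (x * c⁻¹)) := by
    intro a ha hac
    have hi := tendsto_atTop_of_tendsto_div hc hac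
    have hcount := tendsto_count ha hi
    refine ((hx.comp hcount).mul (tendsto_count_div ha hc hac)).congr' ?_
    filter_upwards [hcount.eventually_ge_atTop 1, eventually_gt_atTop 0] with t h1 h2
    simp only [Function.comp]
    rw [hS]
    have : (count a t : ℝ) ≠ 0 := by positivity
    field_simp
  -- Customers present at time `t` have accumulated between nothing and their full sojourn. The
  -- integral thus lies between the total sojourn of those departed and of those arrived by `t`;
  -- both totals have the same asymptotics.
  refine tendsto_of_tendsto_of_tendsto_of_le_of_le' (hlim hD hDc) (hlim hτ hτc) ?_ ?_
  · filter_upwards [eventually_ge_atTop 0] with t ht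
    rw [hint t ht]
    refine mul_le_mul_of_nonneg_left ?_ (by positivity)
    have h1 : ∑ l ∈ Finset.Icc 1 (count D t), (t - τ l) ≤
        ∑ l ∈ Finset.Icc 1 (count τ t), (t - τ l) := by
      refine Finset.sum_le_sum_of_subset_of_nonneg (hsub t) fun l hl _ => ?_
      rw [Finset.mem_Icc] at hl
      exact sub_nonneg.2 ((le_count_iff hτ hτi hl.1).1 hl.2)
    have h2 : ∑ l ∈ Finset.Icc 1 (count D t), (D l - τ l) =
        ∑ l ∈ Finset.Icc 1 (count D t), (t - τ l) - ∑ l ∈ Finset.Icc 1 (count D t), (t - D l) := by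
      rw [← Finset.sum_sub_distrib]
      exact Finset.sum_congr rfl fun l _ => by ring
    linarith
  · filter_upwards [eventually_ge_atTop 0] with t ht
    rw [hint t ht]
    refine mul_le_mul_of_nonneg_left ?_ (by positivity)
    have h1 : ∑ l ∈ Finset.Icc 1 (count τ t), (t - D l) ≤
        ∑ l ∈ Finset.Icc 1 (count D t), (t - D l) := by
      rw [← Finset.sum_sdiff (hsub t)]
      refine add_le_of_nonpos_left (Finset.sum_nonpos fun l hl => ?_)
      simp only [Finset.mem_sdiff, Finset.mem_Icc, not_and, not_le] at hl
      have h3 := hl.2 hl.1.1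
      have : ¬ D l ≤ t := fun h => absurd ((le_count_iff hD hDi hl.1.1).2 h) (by omega)
      linarith
    have h2 : ∑ l ∈ Finset.Icc 1 (count τ t), (D l - τ l) =
        ∑ l ∈ Finset.Icc 1 (count τ t), (t - τ l) - ∑ l ∈ Finset.Icc 1 (count τ t), (t - D l) := by
      rw [← Finset.sum_sub_distrib]
      exact Finset.sum_congr rfl fun l _ => by ring
    linarith


/-! ### A strong law under geometric decay of covariances. -/

section StrongLaw

variable {Ω : Type*} [MeasurableSpace Ω] {P : Measure Ω}

/-- Each new term adds its own second moment and twice its covariances with its predecessors, at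
most two geometric series, so the second moment of the sum grows linearly. -/
lemma integral_sq_sum_le {Z : ℕ → Ω → ℝ} (hZ : ∀ i, MemLp (Z i) 2 P) {C ρ : ℝ} (hC : 0 ≤ C)
    (hρ0 : 0 ≤ ρ) (hρ1 : ρ < 1)
    (hcov : ∀ i j, i ≤ j → ∫ ω, Z i ω * Z j ω ∂P ≤ C * ρ ^ (j - i)) (n : ℕ) :
    ∫ ω, (∑ i ∈ Finset.range n, Z i ω) ^ 2 ∂P ≤ n * (2 * C * (1 - ρ)⁻¹) := by
  induction n with
  | zero => simp
  | succ n ih =>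
    have hS : MemLp (fun ω => ∑ i ∈ Finset.range n, Z i ω) 2 P :=
      memLp_finsetSum _ fun i _ => hZ i
    have hmul : ∀ i j, Integrable (fun ω => Z i ω * Z j ω) P := fun i j =>
      (hZ i).integrable_mul (hZ j)
    have hSZ : Integrable (fun ω => (∑ i ∈ Finset.range n, Z i ω) * Z n ω) P :=
      hS.integrable_mul (hZ n)
    have h0 : Integrable (fun ω => (∑ i ∈ Finset.range n, Z i ω) ^ 2 +
        2 * ((∑ i ∈ Finset.range n, Z i ω) * Z n ω)) P :=
      hS.integrable_sq.add (hSZ.const_mul 2)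
    have h1 : ∫ ω, (∑ i ∈ Finset.range (n + 1), Z i ω) ^ 2 ∂P =
        ∫ ω, (∑ i ∈ Finset.range n, Z i ω) ^ 2 ∂P +
          2 * ∑ i ∈ Finset.range n, ∫ ω, Z i ω * Z n ω ∂P + ∫ ω, Z n ω * Z n ω ∂P := by
      rw [← integral_finsetSum _ fun i _ => hmul i n]
      simp_rw [← Finset.sum_mul]
      rw [← integral_const_mul, ← integral_add hS.integrable_sq (hSZ.const_mul 2),
        ← integral_add h0 (hmul n n)]
      refine integral_congr_ae (ae_of_all _ fun ω => ?_)
      simp only [Finset.sum_range_succ]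
      ring
    have h2 : ∑ i ∈ Finset.range n, ∫ ω, Z i ω * Z n ω ∂P ≤
        ∑ i ∈ Finset.range n, C * ρ ^ (n - i) :=
      Finset.sum_le_sum fun i hi => hcov i n (Finset.mem_range.1 hi).le
    have h3 : ∫ ω, Z n ω * Z n ω ∂P ≤ C := by simpa using hcov n n le_rfl
    have h4 : ∑ i ∈ Finset.range n, C * ρ ^ (n - i) + C ≤ C * (1 - ρ)⁻¹ := by
      have : ∑ i ∈ Finset.range n, C * ρ ^ (n - i) + C =
          C * ∑ i ∈ Finset.range (n + 1), ρ ^ i := by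
        rw [← Finset.sum_range_reflect (fun i => ρ ^ i), Finset.sum_range_succ, mul_add,
          Finset.mul_sum]
        simp
      rw [this, ← tsum_geometric_of_lt_one hρ0 hρ1]
      exact mul_le_mul_of_nonneg_left ((summable_geometric_of_lt_one hρ0 hρ1).sum_le_tsum _
        fun i _ => pow_nonneg hρ0 i) hC
    rw [h1]
    push_cast
    nlinarith [hC]

/-- Along the squares, the averages have second moments at most `B / (n + 1) ^ 2`. These are
summable, so the series of squared averages converges almost everywhere. -/
lemma ae_tendsto_sum_div_sq_zero [IsFiniteMeasure P] {Z : ℕ → Ω → ℝ} (hZ : ∀ i, MemLp (Z i) 2 P)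
    {B : ℝ} (hB : ∀ n : ℕ, ∫ ω, (∑ i ∈ Finset.range n, Z i ω) ^ 2 ∂P ≤ n * B) :
    ∀ᵐ ω ∂P, Tendsto (fun n : ℕ => (∑ i ∈ Finset.range ((n + 1) ^ 2), Z i ω) / ((n + 1 : ℕ) ^ 2 : ℝ))
      atTop (𝓝 0) := by
  set W : ℕ → Ω → ℝ := fun n ω =>
    (∑ i ∈ Finset.range ((n + 1) ^ 2), Z i ω) / ((n + 1 : ℕ) ^ 2 : ℝ) with hW
  have hWL : ∀ n, MemLp (W n) 2 P := fun n => by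
    have := (memLp_finsetSum (Finset.range ((n + 1) ^ 2)) fun i _ => hZ i).mul_const
      (((n + 1 : ℕ) ^ 2 : ℝ)⁻¹)
    simpa only [hW, div_eq_mul_inv] using this
  have hle : ∀ n, ∫⁻ ω, ENNReal.ofReal (W n ω ^ 2) ∂P ≤
      ENNReal.ofReal (B * (1 / ((n + 1 : ℕ) : ℝ) ^ 2)) := by
    intro n
    rw [← ofReal_integral_eq_lintegral_ofReal (hWL n).integrable_sq (ae_of_all _ fun _ => sq_nonneg _)]
    refine ENNReal.ofReal_le_ofReal ?_
    simp only [hW, div_pow]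
    rw [integral_div]
    have := hB ((n + 1) ^ 2)
    have hp : (0 : ℝ) < ((n + 1 : ℕ) : ℝ) := by positivity
    rw [div_le_iff₀ (by positivity)]
    refine this.trans (le_of_eq ?_)
    push_cast at hp ⊢
    field_simp
  have hsum : ∑' n, ENNReal.ofReal (B * (1 / ((n + 1 : ℕ) : ℝ) ^ 2)) ≠ ⊤ := by
    refine Summable.tsum_ofReal_ne_top ?_
    exact ((summable_nat_add_iff 1).2 (Real.summable_one_div_nat_pow.2 one_lt_two)).mul_left B
  have hfin : ∫⁻ ω, ∑' n, ENNReal.ofReal (W n ω ^ 2) ∂P ≠ ⊤ := by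
    rw [lintegral_tsum fun n => ((hWL n).1.aemeasurable.pow_const 2).ennreal_ofReal]
    exact ne_top_of_le_ne_top hsum (ENNReal.tsum_le_tsum hle)
  have hmeas : AEMeasurable (fun ω => ∑' n, ENNReal.ofReal (W n ω ^ 2)) P :=
    AEMeasurable.tsum fun n => ((hWL n).1.aemeasurable.pow_const 2).ennreal_ofReal
  filter_upwards [ae_lt_top' hmeas hfin] with ω hω
  have h1 := ENNReal.tendsto_atTop_zero_of_tsum_ne_top hω.ne
  have h2 := (ENNReal.tendsto_toReal ENNReal.zero_ne_top).comp h1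
  have h3 : Tendsto (fun n => W n ω ^ 2) atTop (𝓝 0) := by
    refine (by simpa using h2 : Tendsto _ _ (𝓝 (0 : ℝ))).congr fun n => ?_
    simp [ENNReal.toReal_ofReal (sq_nonneg _)]
  have h4 := h3.sqrt
  simp only [Real.sqrt_sq_eq_abs, Real.sqrt_zero] at h4
  exact (tendsto_zero_iff_abs_tendsto_zero _).2 h4

/-- A strong law of large numbers for nonnegative random variables with a common mean whose
covariances decay geometrically. -/
theorem ae_tendsto_average_of_covariance_le [IsProbabilityMeasure P] {Y : ℕ → Ω → ℝ}
    (hY : ∀ i, MemLp (Y i) 2 P) (hY0 : ∀ i ω, 0 ≤ Y i ω) {c C ρ : ℝ} (hC : 0 ≤ C)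
    (hρ0 : 0 ≤ ρ) (hρ1 : ρ < 1) (hmean : ∀ i, ∫ ω, Y i ω ∂P = c)
    (hcov : ∀ i j, i ≤ j → ∫ ω, Y i ω * Y j ω ∂P ≤ c ^ 2 + C * ρ ^ (j - i)) :
    ∀ᵐ ω ∂P, Tendsto (fun n : ℕ => (∑ i ∈ Finset.range n, Y i ω) / n) atTop (𝓝 c) := by
  have hi : ∀ i, Integrable (Y i) P := fun i => (hY i).integrable one_le_two
  have hZ : ∀ i, MemLp (fun ω => Y i ω - c) 2 P := fun i => (hY i).sub (memLp_const c)
  have hZcov : ∀ i j, i ≤ j → ∫ ω, (Y i ω - c) * (Y j ω - c) ∂P ≤ C * ρ ^ (j - i) := by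
    intro i j hij
    have h1 : ∫ ω, (Y i ω - c) * (Y j ω - c) ∂P = ∫ ω, Y i ω * Y j ω ∂P - c ^ 2 := by
      have h2 : ∀ ω, (Y i ω - c) * (Y j ω - c) =
          Y i ω * Y j ω - c * Y j ω - c * Y i ω + c ^ 2 := fun ω => by ring
      have hm : Integrable (fun ω => Y i ω * Y j ω) P := (hY i).integrable_mul (hY j)
      have h3 : Integrable (fun ω => Y i ω * Y j ω - c * Y j ω) P := hm.sub ((hi j).const_mul c)
      have h4 : Integrable (fun ω => Y i ω * Y j ω - c * Y j ω - c * Y i ω) P :=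
        h3.sub ((hi i).const_mul c)
      simp_rw [h2]
      rw [integral_add h4 (integrable_const _), integral_sub h3 ((hi i).const_mul c),
        integral_sub hm ((hi j).const_mul c), integral_const_mul, integral_const_mul, hmean, hmean]
      simp
      ring
    linarith [hcov i j hij]
  filter_upwards [ae_tendsto_sum_div_sq_zero hZ
    (integral_sq_sum_le hZ hC hρ0 hρ1 hZcov)] with ω hω
  -- Nonnegativity makes the partial sums monotone, and consecutive squares have ratio tending to 1,
  -- so convergence along the squares fills the gaps.
  refine tendsto_div_of_monotone_of_exists_subseq_tendsto_div _ _ ?_ ?_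
  · intro n k hnk
    exact Finset.sum_le_sum_of_subset_of_nonneg (Finset.range_mono hnk) fun i _ _ => hY0 i ω
  · intro b hb
    refine ⟨fun n => (n + 1) ^ 2, ?_, ?_, ?_⟩
    · have h1 : Tendsto (fun n : ℕ => (((n + 1 : ℕ) : ℝ) + 1) / ((n + 1 : ℕ) : ℝ)) atTop (𝓝 1) := by
        have := (tendsto_add_atTop_iff_nat 1).2
          ((tendsto_one_div_atTop_nhds_zero_nat (𝕜 := ℝ)).const_add 1)
        rw [add_zero] at this
        refine this.congr fun n => ?_
        have : ((n + 1 : ℕ) : ℝ) ≠ 0 := by positivity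
        field_simp
      have h2 := h1.pow 2
      rw [one_pow] at h2
      filter_upwards [h2.eventually_lt_const hb] with n hn
      rw [div_pow, div_lt_iff₀ (by positivity)] at hn
      push_cast at hn ⊢
      exact hn.le
    · exact (tendsto_pow_atTop two_ne_zero).comp (tendsto_add_atTop_nat 1)
    · have h1 := hω.add_const c
      rw [zero_add] at h1
      refine h1.congr fun n => ?_
      rw [Finset.sum_sub_distrib]
      have : ((n + 1 : ℕ) : ℝ) ≠ 0 := by positivity
      simp only [Finset.sum_const, Finset.card_range, nsmul_eq_mul]
      push_cast at this ⊢
      field_simp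
      ring

end StrongLaw


/-! ### The exponential law and its lack of memory. -/

section Exponential

lemma lintegral_expMeasure (r : ℝ) {f : ℝ → ENNReal} (hf : Measurable f) :
    ∫⁻ x, f x ∂(expMeasure r) =
      ∫⁻ x in Set.Ici 0, ENNReal.ofReal (r * Real.exp (-(r * x))) * f x := by
  have h : expMeasure r = volume.withDensity (exponentialPDF r) := rfl
  have hm : Measurable (exponentialPDF r) := (measurable_exponentialPDFReal r).ennreal_ofReal
  rw [h, lintegral_withDensity_eq_lintegral_mul _ hm hf, ← lintegral_indicator measurableSet_Ici]
  refine lintegral_congr fun x => ?_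
  simp only [Pi.mul_apply, exponentialPDF_eq, Set.indicator_apply, Set.mem_Ici]
  split_ifs <;> simp

/-- No sign of `r` is required: the density is carried by `[0, ∞)` and `0` is a null point. This
serves all clocks at once, whatever their rates. -/
lemma ae_pos_expMeasure (r : ℝ) : ∀ᵐ x ∂(expMeasure r), 0 < x := by
  have h : (expMeasure r) (Set.Iic 0) = 0 := by
    rw [← lintegral_indicator_one measurableSet_Iic,
      lintegral_expMeasure r (measurable_one.indicator measurableSet_Iic),
      ← lintegral_indicator measurableSet_Ici]
    refine lintegral_eq_zero_of_ae_eq_zero ?_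
    have : ∀ᵐ x : ℝ, x ≠ 0 := by simp [ae_iff]
    filter_upwards [this] with x hx
    simp only [Set.indicator_apply, Set.mem_Ici, Set.mem_Iic, Pi.zero_apply, Pi.one_apply]
    split_ifs with h1 h2
    · exact absurd (le_antisymm h2 h1) hx
    · simp
    · rfl
  rw [ae_iff]
  simp only [not_lt]
  exact h

lemma expMeasure_Iic {r : ℝ} (hr : 0 < r) {t : ℝ} (ht : 0 ≤ t) :
    expMeasure r (Set.Iic t) = ENNReal.ofReal (1 - Real.exp (-(r * t))) := by
  have := isProbabilityMeasure_expMeasure hr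
  rw [← ofReal_cdf, cdf_expMeasure_eq hr, if_pos ht]

lemma expMeasure_Ioi {r : ℝ} (hr : 0 < r) {t : ℝ} (ht : 0 ≤ t) :
    expMeasure r (Set.Ioi t) = ENNReal.ofReal (Real.exp (-(r * t))) := by
  have := isProbabilityMeasure_expMeasure hr
  have h0 : Real.exp (-(r * t)) ≤ 1 := Real.exp_le_one_iff.2 (by nlinarith)
  rw [← Set.compl_Iic, prob_compl_eq_one_sub measurableSet_Iic, expMeasure_Iic hr ht,
    ← ENNReal.ofReal_one, ← ENNReal.ofReal_sub _ (by linarith)]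
  congr 1
  ring

/-- The memoryless property of the exponential distribution. -/
lemma setLIntegral_Ici_expMeasure (r : ℝ) {f : ℝ → ENNReal} (hf : Measurable f) {s : ℝ}
    (hs : 0 ≤ s) :
    ∫⁻ x in Set.Ici s, f (x - s) ∂(expMeasure r) =
      ENNReal.ofReal (Real.exp (-(r * s))) * ∫⁻ x, f x ∂(expMeasure r) := by
  have hm : Measurable ((Set.Ici s).indicator fun x => f (x - s)) :=
    (hf.comp (measurable_id.sub_const s)).indicator measurableSet_Ici
  rw [← lintegral_indicator measurableSet_Ici, lintegral_expMeasure r hm, lintegral_expMeasure r hf,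
    ← lintegral_const_mul _ (by fun_prop), ← lintegral_indicator measurableSet_Ici,
    ← lintegral_indicator measurableSet_Ici]
  rw [← lintegral_add_right_eq_self _ s]
  refine lintegral_congr fun x => ?_
  simp only [Set.indicator_apply, Set.mem_Ici, add_sub_cancel_right]
  by_cases hx : 0 ≤ x
  · rw [if_pos (by linarith), if_pos (by linarith), if_pos hx, ← mul_assoc,
      ← ENNReal.ofReal_mul (Real.exp_pos _).le]
    congr 2
    rw [mul_add, neg_add, Real.exp_add]
    ring
  · rw [if_neg (show ¬ s ≤ x + s by linarith), if_neg hx]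
    simp

end Exponential

/-! ### Order statistics of independent exponentials. -/

section OrderStat

variable {ι : Type*} [Fintype ι]

/-- The `K`-th smallest value of a finite family (`0` if `K = 0`). -/
noncomputable def orderStat (K : ℕ) (x : ι → ENNReal) : ENNReal :=
  (Finset.powersetCard K Finset.univ).inf fun A => A.sup x

/-- A `K`-subset with supremum at most `u` is a `K`-subset of the sublevel set. The bound `u < ⊤` is
needed when `K` exceeds the size of the family: the infimum is then over nothing and equals `⊤`. -/
lemma orderStat_le_iff {K : ℕ} {x : ι → ENNReal} {u : ENNReal} (hu : u < ⊤) :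
    orderStat K x ≤ u ↔ K ≤ (Finset.univ.filter fun i => x i ≤ u).card := by
  rw [orderStat, Finset.inf_le_iff hu]
  simp only [Finset.mem_powersetCard_univ, Finset.sup_le_iff]
  constructor
  · rintro ⟨A, rfl, hA⟩
    exact Finset.card_le_card fun i hi => by simpa using hA i hi
  · intro h
    obtain ⟨A, hA, hc⟩ := Finset.exists_subset_card_eq h
    exact ⟨A, hc, fun i hi => by simpa using hA hi⟩

lemma orderStat_mono (K : ℕ) : Monotone (orderStat K : (ι → ENNReal) → ENNReal) := fun _ _ h =>
  Finset.inf_mono_fun fun _ _ => Finset.sup_mono_fun fun i _ => h i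

lemma orderStat_le_sum {K : ℕ} (hK : K ≤ Fintype.card ι) (x : ι → ENNReal) :
    orderStat K x ≤ ∑ i, x i := by
  obtain ⟨A, -, hA⟩ := Finset.exists_subset_card_eq (s := (Finset.univ : Finset ι)) hK
  refine (Finset.inf_le (Finset.mem_powersetCard_univ.2 hA)).trans ?_
  exact Finset.sup_le fun i _ => Finset.single_le_sum (f := x) (fun _ _ => zero_le) (Finset.mem_univ i)

lemma measurable_orderStat (K : ℕ) : Measurable (orderStat K : (ι → ENNReal) → ENNReal) := by
  unfold orderStat
  simp_rw [Finset.inf_eq_iInf, Finset.sup_eq_iSup]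
  exact Measurable.iInf fun A => Measurable.iInf fun _ => Measurable.iSup fun i =>
    Measurable.iSup fun _ => measurable_pi_apply i

/-- The integrand `b j` is the probability that exactly `j` of `n` clocks have rung by time `t`, so
the integral is the mean time spent with `j` clocks rung. The forward equation `b (j+1)' = r (n - j)
b j - r (n - j - 1) b (j+1)` integrates to 0 over `(0, ∞)`; hence `r (n - j) ∫ b j` does not depend
on `j`, and it is 1 at `j = 0`. -/
lemma integral_binomial_exp {r : ℝ} (hr : 0 < r) (n : ℕ) {j : ℕ} (hj : j < n) :
    IntegrableOn (fun t : ℝ => (n.choose j : ℝ) * (1 - Real.exp (-(r * t))) ^ j *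
      Real.exp (-(r * t)) ^ (n - j)) (Set.Ioi 0) ∧
    ∫ t in Set.Ioi (0 : ℝ), (n.choose j : ℝ) * (1 - Real.exp (-(r * t))) ^ j *
      Real.exp (-(r * t)) ^ (n - j) = 1 / (r * ((n : ℝ) - j)) := by
  have hint : ∀ j, j < n → IntegrableOn (fun t : ℝ => (n.choose j : ℝ) *
      (1 - Real.exp (-(r * t))) ^ j * Real.exp (-(r * t)) ^ (n - j)) (Set.Ioi 0) := by
    intro j hj
    have h1 : IntegrableOn (fun t : ℝ => (n.choose j : ℝ) * Real.exp (-r * t)) (Set.Ioi 0) :=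
      (integrableOn_exp_mul_Ioi (neg_lt_zero.2 hr) 0).const_mul _
    refine Integrable.mono' h1 (Measurable.aestronglyMeasurable (by fun_prop)) ?_
    filter_upwards [ae_restrict_mem measurableSet_Ioi] with t ht
    have h2 : 0 ≤ Real.exp (-(r * t)) := (Real.exp_pos _).le
    have h3 : Real.exp (-(r * t)) ≤ 1 := Real.exp_le_one_iff.2 (by
      have := mul_pos hr ht; linarith)
    rw [Real.norm_of_nonneg (by have := sub_nonneg.2 h3; positivity), mul_assoc]
    refine mul_le_mul_of_nonneg_left ?_ (by positivity)
    have h4 : (1 - Real.exp (-(r * t))) ^ j ≤ 1 := pow_le_one₀ (by linarith) (by linarith)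
    have h5 : Real.exp (-(r * t)) ^ (n - j) ≤ Real.exp (-(r * t)) :=
      pow_le_of_le_one h2 h3 (by omega)
    calc _ ≤ 1 * Real.exp (-(r * t)) := by gcongr
      _ = _ := by rw [one_mul, neg_mul]
  refine ⟨hint j hj, ?_⟩
  induction j with
  | zero =>
    have hn : (0 : ℝ) < n := by exact_mod_cast hj
    have h1 : ∀ t : ℝ, (n.choose 0 : ℝ) * (1 - Real.exp (-(r * t))) ^ 0 *
        Real.exp (-(r * t)) ^ (n - 0) = Real.exp (-(r * n) * t) := by
      intro t
      rw [← Real.exp_nat_mul]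
      simp
      ring
    simp_rw [h1]
    rw [integral_exp_mul_Ioi (by have := mul_pos hr hn; linarith)]
    simp [neg_div_neg_eq]
  | succ j ih =>
    have ih := ih (by omega)
    have hd : ∀ t : ℝ, HasDerivAt (fun t : ℝ => (n.choose (j + 1) : ℝ) *
        (1 - Real.exp (-(r * t))) ^ (j + 1) * Real.exp (-(r * t)) ^ (n - (j + 1)))
        (r * ((n : ℝ) - j) * ((n.choose j : ℝ) * (1 - Real.exp (-(r * t))) ^ j *
          Real.exp (-(r * t)) ^ (n - j)) - r * ((n : ℝ) - (j + 1 : ℕ)) *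
          ((n.choose (j + 1) : ℝ) * (1 - Real.exp (-(r * t))) ^ (j + 1) *
          Real.exp (-(r * t)) ^ (n - (j + 1)))) t := by
      intro t
      have he : HasDerivAt (fun t : ℝ => Real.exp (-(r * t))) (Real.exp (-(r * t)) * (-r)) t := by
        have := ((hasDerivAt_id t).const_mul r).neg.exp
        simpa using this
      have := (((he.const_sub 1).pow (j + 1)).const_mul (n.choose (j + 1) : ℝ)).mul
        (he.pow (n - (j + 1)))
      refine this.congr_deriv ?_
      have hc : ((n.choose (j + 1) : ℕ) : ℝ) * (j + 1) = n.choose j * ((n : ℝ) - j) := by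
        have := Nat.choose_succ_right_eq n j
        have h2 : ((n - j : ℕ) : ℝ) = (n : ℝ) - j := Nat.cast_sub (by omega)
        rw [← h2]
        exact_mod_cast this
      -- This parametrization removes the truncated subtractions from the exponents.
      obtain ⟨p, rfl⟩ : ∃ p, n = j + 1 + (p + 1) := ⟨n - (j + 1) - 1, by omega⟩
      have e1 : j + 1 + (p + 1) - (j + 1) = p + 1 := by omega
      have e2 : j + 1 + (p + 1) - j = p + 2 := by omega
      simp only [e1, e2, Pi.pow_apply, Nat.add_sub_cancel]
      push_cast at hc ⊢
      set q := Real.exp (-(r * t))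
      linear_combination (r * (1 - q) ^ j * q ^ (p + 2)) * hc
    have hI : IntegrableOn (fun t : ℝ => r * ((n : ℝ) - j) * ((n.choose j : ℝ) *
          (1 - Real.exp (-(r * t))) ^ j *
          Real.exp (-(r * t)) ^ (n - j)) - r * ((n : ℝ) - (j + 1 : ℕ)) *
          ((n.choose (j + 1) : ℝ) * (1 - Real.exp (-(r * t))) ^ (j + 1) *
          Real.exp (-(r * t)) ^ (n - (j + 1)))) (Set.Ioi 0) :=
      ((hint j (by omega)).const_mul _).sub ((hint (j + 1) hj).const_mul _)
    have hlim : Tendsto (fun t : ℝ => (n.choose (j + 1) : ℝ) *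
        (1 - Real.exp (-(r * t))) ^ (j + 1) * Real.exp (-(r * t)) ^ (n - (j + 1)))
        atTop (𝓝 0) := by
      have h1 : Tendsto (fun t : ℝ => Real.exp (-(r * t))) atTop (𝓝 0) :=
        Real.tendsto_exp_neg_atTop_nhds_zero.comp (tendsto_id.const_mul_atTop hr)
      have := (((h1.const_sub 1).pow (j + 1)).const_mul (n.choose (j + 1) : ℝ)).mul
        (h1.pow (n - (j + 1)))
      rwa [zero_pow (by omega), mul_zero] at this
    have := integral_Ioi_of_hasDerivAt_of_tendsto' (fun t _ => hd t) hI hlim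
    rw [integral_sub ((hint j (by omega)).const_mul _) ((hint (j + 1) hj).const_mul _),
      integral_const_mul, integral_const_mul, ih] at this
    have hj1 : (0 : ℝ) < (n : ℝ) - (j + 1 : ℕ) := sub_pos.2 (by exact_mod_cast hj)
    have hj0 : (0 : ℝ) < (n : ℝ) - j := sub_pos.2 (by exact_mod_cast (by omega : j < n))
    rw [mul_one_div_cancel (mul_pos hr hj0).ne'] at this
    simp only [mul_zero, neg_zero, Real.exp_zero, sub_self, ne_eq, Nat.succ_ne_zero,
      not_false_eq_true, zero_pow, zero_mul] at this
    rw [eq_div_iff (mul_pos hr hj1).ne']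
    linarith

/-- The probability that at most `K - 1` of finitely many independent random variables with law `ν`
are at most `t`. -/
lemma pi_card_le_lt (ν : Measure ℝ) [IsProbabilityMeasure ν] (K : ℕ) (t : ℝ)
    (hK : K ≤ Fintype.card ι) :
    (Measure.pi fun _ : ι => ν) {x | (Finset.univ.filter fun i => x i ≤ t).card < K} =
      ∑ j ∈ Finset.range K, ((Fintype.card ι).choose j) •
        (ν (Set.Iic t) ^ j * ν (Set.Ioi t) ^ (Fintype.card ι - j)) := by
  classical
  set F : Finset (Finset ι) := Finset.univ.filter fun A => A.card < K with hF
  -- `box A` is the event that the coordinates at most `t` are exactly those in `A`; these events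
  -- are disjoint product sets.
  set box : Finset ι → Set (ι → ℝ) := fun A =>
    Set.univ.pi fun i => if i ∈ A then Set.Iic t else Set.Ioi t with hbox
  have hmem : ∀ A x, x ∈ box A ↔ (Finset.univ.filter fun i => x i ≤ t) = A := by
    intro A x
    simp only [hbox, Set.mem_pi, Set.mem_univ, true_implies, Finset.ext_iff, Finset.mem_filter,
      Finset.mem_univ, true_and]
    refine forall_congr' fun i => ?_
    by_cases h : i ∈ A <;> simp [h]
  have h1 : {x : ι → ℝ | (Finset.univ.filter fun i => x i ≤ t).card < K} = ⋃ A ∈ F, box A := by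
    ext x
    simp only [Set.mem_iUnion, hmem, hF, Finset.mem_filter, Finset.mem_univ, true_and,
      Set.mem_ofPred_eq, exists_prop]
    exact ⟨fun h => ⟨_, h, rfl⟩, by rintro ⟨A, h, rfl⟩; exact h⟩
  rw [h1, measure_biUnion_finset]
  · have h2 : ∀ A ∈ F, (Measure.pi fun _ : ι => ν) (box A) =
        ν (Set.Iic t) ^ A.card * ν (Set.Ioi t) ^ (Fintype.card ι - A.card) := by
      intro A _
      rw [Measure.pi_pi]
      simp_rw [apply_ite ν]
      rw [Finset.prod_ite, Finset.prod_const, Finset.prod_const, Finset.filter_mem_eq_inter,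
        Finset.univ_inter, Finset.filter_not, Finset.filter_mem_eq_inter, Finset.univ_inter,
        ← Finset.compl_eq_univ_sdiff, Finset.card_compl]
    rw [Finset.sum_congr rfl h2, hF, Finset.sum_filter, ← Finset.powerset_univ,
      Finset.sum_powerset_apply_card (fun j => if j < K then
        ν (Set.Iic t) ^ j * ν (Set.Ioi t) ^ (Fintype.card ι - j) else 0), Finset.card_univ]
    simp_rw [smul_ite, smul_zero]
    rw [← Finset.sum_filter]
    refine Finset.sum_congr ?_ fun _ _ => rfl
    ext j
    simp only [Finset.mem_filter, Finset.mem_range]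
    omega
  · intro A _ B _ hAB
    refine Set.disjoint_left.2 fun x hA hB => hAB ?_
    rw [← (hmem A x).1 hA, (hmem B x).1 hB]
  · intro A _
    refine MeasurableSet.univ_pi fun i => ?_
    split_ifs
    exacts [measurableSet_Iic, measurableSet_Ioi]

/-- The expectation of the `K`-th order statistic of `n` independent exponential random variables. -/
noncomputable def orderStatMean (r : ℝ) (n K : ℕ) : ℝ :=
  ∑ j ∈ Finset.range K, 1 / (r * ((n : ℝ) - j))

lemma orderStatMean_nonneg {r : ℝ} (hr : 0 < r) {n K : ℕ} (hK : K ≤ n) :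
    0 ≤ orderStatMean r n K := by
  refine Finset.sum_nonneg fun j hj => ?_
  have : (j : ℝ) < n := by exact_mod_cast (Finset.mem_range.1 hj).trans_le hK
  have := sub_pos.2 this
  positivity

/-- By the layer-cake formula the mean is the integral of the tail. The order statistic exceeds `t`
when fewer than `K` values are at most `t`, a binomial sum that is integrated term by term. -/
theorem lintegral_orderStat {r : ℝ} (hr : 0 < r) {K : ℕ} (hK : K ≤ Fintype.card ι) :
    ∫⁻ x, orderStat K (fun i => ENNReal.ofReal (x i)) ∂(Measure.pi fun _ : ι => expMeasure r) =
      ENNReal.ofReal (orderStatMean r (Fintype.card ι) K) := by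
  have := isProbabilityMeasure_expMeasure hr
  set f : (ι → ℝ) → ENNReal := fun x => orderStat K (fun i => ENNReal.ofReal (x i)) with hf
  have hfm : Measurable f := (measurable_orderStat K).comp
    (measurable_pi_lambda _ fun i => (measurable_pi_apply i).ennreal_ofReal)
  have hft : ∀ x, f x ≠ ⊤ := fun x => ne_top_of_le_ne_top
    (ENNReal.sum_ne_top.2 fun i _ => ENNReal.ofReal_ne_top) (orderStat_le_sum hK _)
  have h1 : ∫⁻ x, f x ∂(Measure.pi fun _ : ι => expMeasure r) =
      ∫⁻ x, ENNReal.ofReal (f x).toReal ∂(Measure.pi fun _ : ι => expMeasure r) :=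
    lintegral_congr fun x => (ENNReal.ofReal_toReal (hft x)).symm
  rw [h1, lintegral_eq_lintegral_meas_lt _ (ae_of_all _ fun x => ENNReal.toReal_nonneg)
    hfm.ennreal_toReal.aemeasurable]
  have h2 : ∀ t ∈ Set.Ioi (0 : ℝ), (Measure.pi fun _ : ι => expMeasure r) {x | t < (f x).toReal} =
      ENNReal.ofReal (∑ j ∈ Finset.range K, ((Fintype.card ι).choose j : ℝ) *
        (1 - Real.exp (-(r * t))) ^ j * Real.exp (-(r * t)) ^ (Fintype.card ι - j)) := by
    intro t ht
    have ht : 0 < t := ht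
    have h3 : {x | t < (f x).toReal} =
        {x : ι → ℝ | (Finset.univ.filter fun i => x i ≤ t).card < K} := by
      ext x
      simp only [Set.mem_ofPred_eq]
      rw [← ENNReal.ofReal_lt_iff_lt_toReal ht.le (hft x), ← not_le, ← not_le, hf,
        orderStat_le_iff ENNReal.ofReal_lt_top]
      simp only [ENNReal.ofReal_le_ofReal_iff ht.le]
    have h0 : 0 ≤ 1 - Real.exp (-(r * t)) := sub_nonneg.2 (Real.exp_le_one_iff.2
      (by have := mul_pos hr ht; linarith))
    rw [h3, pi_card_le_lt _ _ _ hK, ENNReal.ofReal_sum_of_nonneg fun j _ => by positivity]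
    refine Finset.sum_congr rfl fun j _ => ?_
    rw [expMeasure_Iic hr ht.le, expMeasure_Ioi hr ht.le, nsmul_eq_mul,
      ENNReal.ofReal_mul (by positivity), ENNReal.ofReal_mul (by positivity),
      ENNReal.ofReal_pow h0, ENNReal.ofReal_pow (Real.exp_pos _).le, ENNReal.ofReal_natCast,
      mul_assoc]
  rw [setLIntegral_congr_fun measurableSet_Ioi h2]
  have hj : ∀ j ∈ Finset.range K, j < Fintype.card ι := fun j hj =>
    (Finset.mem_range.1 hj).trans_le hK
  rw [← ofReal_integral_eq_lintegral_ofReal]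
  · rw [integral_finsetSum _ fun j hjK => (integral_binomial_exp hr _ (hj j hjK)).1]
    congr 1
    exact Finset.sum_congr rfl fun j hjK => (integral_binomial_exp hr _ (hj j hjK)).2
  · exact integrable_finsetSum _ fun j hjK => (integral_binomial_exp hr _ (hj j hjK)).1
  · filter_upwards [ae_restrict_mem measurableSet_Ioi] with t ht
    have h0 : 0 ≤ 1 - Real.exp (-(r * t)) := sub_nonneg.2 (Real.exp_le_one_iff.2
      (by have := mul_pos hr ht; linarith))
    simp only [Pi.zero_apply]
    positivity

end OrderStat


/-! ### First-step decomposition of i.i.d. sequences. -/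

section Sequences

/-- The sequence with first term `x` followed by the terms of `g`. -/
def consSeq (x : ℝ) (g : ℕ → ℝ) : ℕ → ℝ
  | 0 => x
  | n + 1 => g n

@[simp] lemma consSeq_zero (x : ℝ) (g : ℕ → ℝ) : consSeq x g 0 = x := rfl

@[simp] lemma consSeq_succ (x : ℝ) (g : ℕ → ℝ) (n : ℕ) : consSeq x g (n + 1) = g n := rfl

lemma measurable_consSeq : Measurable fun p : ℝ × (ℕ → ℝ) => consSeq p.1 p.2 := by
  refine measurable_pi_lambda _ fun n => ?_
  cases n with
  | zero => exact measurable_fst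
  | succ n => exact (measurable_pi_apply n).comp measurable_snd

lemma sum_range_consSeq (x : ℝ) (g : ℕ → ℝ) (r : ℕ) :
    ∑ i ∈ Finset.range (r + 1), consSeq x g i = x + ∑ i ∈ Finset.range r, g i := by
  rw [Finset.sum_range_succ', add_comm]
  rfl

/-- The law of a sequence of independent random variables with law `ν`. -/
noncomputable abbrev iidSeq (ν : Measure ℝ) [IsProbabilityMeasure ν] : Measure (ℕ → ℝ) :=
  Measure.infinitePi fun _ => ν

/-- Prepending an independent copy preserves the law, as finite-dimensional boxes show. This is what
permits conditioning on the first gap. -/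
lemma map_consSeq (ν : Measure ℝ) [IsProbabilityMeasure ν] :
    (ν.prod (iidSeq ν)).map (fun p : ℝ × (ℕ → ℝ) => consSeq p.1 p.2) = iidSeq ν := by
  refine Measure.eq_infinitePi _ fun s t ht => ?_
  obtain ⟨N, hN⟩ := s.exists_nat_subset_range
  -- Filling the coordinates outside `s` with `univ` replaces the arbitrary index set by an
  -- interval, from which coordinate 0 can be split off.
  set t' : ℕ → Set ℝ := fun i => if i ∈ s then t i else Set.univ with ht'
  have hm : ∀ i, MeasurableSet (t' i) := fun i => by
    simp only [ht']
    split_ifs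
    exacts [ht i, MeasurableSet.univ]
  have h1 : (fun p : ℝ × (ℕ → ℝ) => consSeq p.1 p.2) ⁻¹' (Set.pi s t) =
      t' 0 ×ˢ Set.pi (Finset.range N : Set ℕ) (fun i => t' (i + 1)) := by
    ext p
    simp only [Set.mem_preimage, Set.mem_pi, Set.mem_prod, Finset.mem_coe, Finset.mem_range]
    constructor
    · intro h
      refine ⟨?_, fun i _ => ?_⟩
      · by_cases h0 : 0 ∈ s
        · simpa [ht', h0] using h 0 h0
        · simp [ht', h0]
      · by_cases h0 : i + 1 ∈ s
        · simpa [ht', h0] using h (i + 1) h0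
        · simp [ht', h0]
    · rintro ⟨h0, h⟩ i hi
      cases i with
      | zero => simpa [ht', hi] using h0
      | succ i =>
        have := h i (by have := Finset.mem_range.1 (hN hi); omega)
        simpa [ht', hi] using this
  rw [Measure.map_apply measurable_consSeq (MeasurableSet.pi s.countable_toSet fun i _ => ht i), h1,
    Measure.prod_prod, Measure.infinitePi_pi _ fun i _ => hm (i + 1), mul_comm,
    ← Finset.prod_range_succ' fun i => ν (t' i)]
  rw [← Finset.prod_subset (hN.trans (Finset.range_mono (Nat.le_succ N)))]
  · exact Finset.prod_congr rfl fun i hi => by simp [ht', hi]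
  · intro i _ hi
    simp [ht', hi]

lemma lintegral_iidSeq (ν : Measure ℝ) [IsProbabilityMeasure ν] {f : (ℕ → ℝ) → ENNReal}
    (hf : Measurable f) :
    ∫⁻ g, f g ∂(iidSeq ν) = ∫⁻ x, ∫⁻ g, f (consSeq x g) ∂(iidSeq ν) ∂ν := by
  have hm : Measurable fun p : ℝ × (ℕ → ℝ) => f (consSeq p.1 p.2) := hf.comp measurable_consSeq
  conv_lhs => rw [← map_consSeq ν]
  rw [lintegral_map hf measurable_consSeq, lintegral_prod _ hm.aemeasurable]

lemma ae_iidSeq {ν : Measure ℝ} [IsProbabilityMeasure ν] {p : ℝ → Prop} (h : ∀ᵐ x ∂ν, p x) :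
    ∀ᵐ g ∂(iidSeq ν), ∀ n, p (g n) :=
  ae_all_iff.2 fun n => (measurePreserving_eval_infinitePi (fun _ : ℕ => ν) n).quasiMeasurePreserving.ae h

end Sequences

/-! ### Stationarity of the Poisson process through a renewal equation. -/

section Stationarity

lemma expMeasure_Ici {r : ℝ} (hr : 0 < r) {s : ℝ} (hs : 0 ≤ s) :
    expMeasure r (Set.Ici s) = ENNReal.ofReal (Real.exp (-(r * s))) := by
  have := isProbabilityMeasure_expMeasure hr
  have := setLIntegral_Ici_expMeasure r (f := fun _ => 1) measurable_const hs
  simpa using this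

lemma expMeasure_Ico_add {r : ℝ} (hr : 0 < r) {s : ℝ} (hs : 0 ≤ s) :
    expMeasure r (Set.Ico 0 s) + ENNReal.ofReal (Real.exp (-(r * s))) = 1 := by
  rw [← expMeasure_Ici hr hs, ← measure_union _ measurableSet_Ici, Set.Ico_union_Ici_eq_Ici hs,
    expMeasure_Ici hr le_rfl]
  · simp
  · exact Set.disjoint_left.2 fun x hx hx' => absurd hx.2 (not_lt.2 hx')

/-- A functional of a Poisson process on `[0, ∞)` seen from time `s`, where the process is given by
its sequence of gaps, has a law that does not depend on `s`. -/
theorem map_eq_map_zero_of_cons {r : ℝ} (hr : 0 < r) [IsProbabilityMeasure (expMeasure r)]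
    {β : Type*} [MeasurableSpace β] {G : ℝ → (ℕ → ℝ) → β} (hG : Measurable (Function.uncurry G))
    (h1 : ∀ s x g, 0 ≤ x → x < s → G s (consSeq x g) = G (s - x) g)
    (h2 : ∀ s x g, 0 ≤ s → s ≤ x → G s (consSeq x g) = G 0 (consSeq (x - s) g))
    {s : ℝ} (hs : 0 ≤ s) :
    (iidSeq (expMeasure r)).map (G s) = (iidSeq (expMeasure r)).map (G 0) := by
  have hGs : ∀ s, Measurable (G s) := fun s => hG.comp measurable_prodMk_left
  refine Measure.ext fun B hB => ?_
  rw [Measure.map_apply (hGs s) hB, Measure.map_apply (hGs 0) hB]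
  set Q := iidSeq (expMeasure r) with hQ
  set ν := expMeasure r with hν
  set Φ : ℝ → ENNReal := fun s => Q (G s ⁻¹' B) with hΦ
  have hΦ1 : ∀ s, Φ s = ∫⁻ g, B.indicator 1 (G s g) ∂Q := by
    intro s
    have h3 : (fun g => B.indicator (1 : β → ENNReal) (G s g)) = (G s ⁻¹' B).indicator 1 := by
      ext g
      rfl
    rw [h3, lintegral_indicator_one (hGs s hB)]
  have hBm : Measurable (B.indicator (1 : β → ENNReal)) := measurable_one.indicator hB
  have hBG : ∀ s, Measurable fun g => B.indicator (1 : β → ENNReal) (G s g) := fun s =>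
    hBm.comp (hGs s)
  -- Condition on the first gap `x`: for `x ≥ s`, lack of memory and `h2` restart the process at
  -- `s`; for `x < s`, `h1` restarts it at `x`.
  have hrec : ∀ s, 0 ≤ s → Φ s = ENNReal.ofReal (Real.exp (-(r * s))) * Φ 0 +
      ∫⁻ x in Set.Ico 0 s, Φ (s - x) ∂ν := by
    intro s hs
    rw [hΦ1 s, lintegral_iidSeq _ (hBG s), ← lintegral_add_compl _
      (measurableSet_Ici (a := s))]
    congr 1
    · have h3 : ∀ x ∈ Set.Ici s, ∫⁻ g, B.indicator 1 (G s (consSeq x g)) ∂Q =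
          (fun y => ∫⁻ g, B.indicator 1 (G 0 (consSeq y g)) ∂Q) (x - s) := fun x hx =>
        lintegral_congr fun g => by rw [h2 s x g hs hx]
      have h4 : Measurable fun y => ∫⁻ g, B.indicator (1 : β → ENNReal) (G 0 (consSeq y g)) ∂Q :=
        Measurable.lintegral_prod_right' (f := fun p : ℝ × (ℕ → ℝ) =>
          B.indicator 1 (G 0 (consSeq p.1 p.2))) ((hBG 0).comp measurable_consSeq)
      rw [setLIntegral_congr_fun measurableSet_Ici h3, hΦ1 0, lintegral_iidSeq _ (hBG 0)]
      exact setLIntegral_Ici_expMeasure r h4 hs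
    · rw [← setLIntegral_congr_fun (f := fun x => ∫⁻ g, B.indicator 1 (G s (consSeq x g)) ∂Q)
        measurableSet_Ico]
      · refine setLIntegral_congr ?_
        filter_upwards [ae_pos_expMeasure r] with x hx
        refine propext ?_
        show x ∈ (Set.Ici s)ᶜ ↔ x ∈ Set.Ico 0 s
        simp [hx.le]
      · intro x hx
        show ∫⁻ g, B.indicator 1 (G s (consSeq x g)) ∂Q = Φ (s - x)
        rw [hΦ1]
        exact lintegral_congr fun g => by rw [h1 s x g hx.1 hx.2]
  set q := ν (Set.Ico 0 s) with hq
  have hq1 : q < 1 := by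
    have h3 := expMeasure_Ico_add hr hs
    rw [← h3]
    refine ENNReal.lt_add_right ?_ (ENNReal.ofReal_pos.2 (Real.exp_pos _)).ne'
    exact measure_ne_top _ _
  -- The constant `Φ 0` solves the same renewal equation.
  have hc : ∀ u, 0 ≤ u → ENNReal.ofReal (Real.exp (-(r * u))) * Φ 0 + ν (Set.Ico 0 u) * Φ 0 = Φ 0 := by
    intro u hu
    rw [← add_mul, add_comm, expMeasure_Ico_add hr hu, one_mul]
  -- Iterating the equation contracts the difference of the two solutions by `q < 1` at each step.
  -- Two one-sided bounds replace an absolute value in `ENNReal`.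
  have key : ∀ n : ℕ, ∀ u, 0 ≤ u → u ≤ s → Φ u ≤ Φ 0 + q ^ n ∧ Φ 0 ≤ Φ u + q ^ n := by
    intro n
    induction n with
    | zero =>
      intro u _ _
      rw [pow_zero]
      exact ⟨prob_le_one.trans le_add_self, prob_le_one.trans le_add_self⟩
    | succ n ih =>
      intro u hu hus
      have hle : ν (Set.Ico 0 u) * q ^ n ≤ q ^ (n + 1) := by
        rw [pow_succ']
        exact mul_le_mul_left (measure_mono (Set.Ico_subset_Ico_right hus)) _
      constructor
      · calc Φ u = _ := hrec u hu
          _ ≤ ENNReal.ofReal (Real.exp (-(r * u))) * Φ 0 +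
              ∫⁻ x in Set.Ico 0 u, (Φ 0 + q ^ n) ∂ν := by
            gcongr 1
            exact setLIntegral_mono measurable_const fun x hx =>
              (ih (u - x) (by linarith [hx.2]) (by linarith [hx.1])).1
          _ = Φ 0 + ν (Set.Ico 0 u) * q ^ n := by
            rw [setLIntegral_const, mul_comm _ (ν _), mul_add, ← add_assoc, hc u hu]
          _ ≤ _ := by gcongr
      · calc Φ 0 = _ := (hc u hu).symm
          _ = ENNReal.ofReal (Real.exp (-(r * u))) * Φ 0 + ∫⁻ x in Set.Ico 0 u, Φ 0 ∂ν := by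
            rw [setLIntegral_const, mul_comm (ν _)]
          _ ≤ ENNReal.ofReal (Real.exp (-(r * u))) * Φ 0 +
              ∫⁻ x in Set.Ico 0 u, (Φ (u - x) + q ^ n) ∂ν := by
            gcongr 1
            exact setLIntegral_mono' measurableSet_Ico fun x hx =>
              (ih (u - x) (by linarith [hx.2]) (by linarith [hx.1])).2
          _ = Φ u + ν (Set.Ico 0 u) * q ^ n := by
            rw [lintegral_add_right _ measurable_const, setLIntegral_const, ← add_assoc,
              ← hrec u hu, mul_comm (q ^ n)]
          _ ≤ _ := by gcongr
  have hlim : Tendsto (fun n : ℕ => q ^ n) atTop (𝓝 0) :=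
    ENNReal.tendsto_pow_atTop_nhds_zero_of_lt_one hq1
  refine le_antisymm ?_ ?_
  · have := hlim.const_add (Φ 0)
    rw [add_zero] at this
    exact ge_of_tendsto' this fun n => (key n s hs le_rfl).1
  · have := hlim.const_add (Φ s)
    rw [add_zero] at this
    exact ge_of_tendsto' this fun n => (key n s hs le_rfl).2

end Stationarity

/-! ### Residual times and their joint law at two instants. -/

section Residual

/-- The time from `s` until the next event of the point process with gaps `g`. -/
noncomputable def residual (s : ℝ) (g : ℕ → ℝ) : ENNReal :=
  ⨅ r : ℕ, if s ≤ ∑ i ∈ Finset.range (r + 1), g i then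
    ENNReal.ofReal (∑ i ∈ Finset.range (r + 1), g i - s) else ⊤

lemma measurable_residual : Measurable (Function.uncurry residual) := by
  refine Measurable.iInf fun r => ?_
  have h : Measurable fun p : ℝ × (ℕ → ℝ) => ∑ i ∈ Finset.range (r + 1), p.2 i :=
    Finset.measurable_fun_sum _ fun i _ => (measurable_pi_apply i).comp measurable_snd
  exact Measurable.ite (measurableSet_le measurable_fst h) (h.sub measurable_fst).ennreal_ofReal
    measurable_const

lemma residual_consSeq_of_lt {s x : ℝ} {g : ℕ → ℝ} (hx : x < s) :
    residual s (consSeq x g) = residual (s - x) g := by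
  unfold residual
  refine le_antisymm (le_iInf fun r => (iInf_le _ (r + 1)).trans ?_) (le_iInf fun r => ?_)
  · simp only [sum_range_consSeq, sub_le_iff_le_add']
    rw [sub_sub_eq_add_sub, add_comm x]
  · cases r with
    | zero => simp [not_le.2 hx]
    | succ r =>
      refine (iInf_le _ r).trans ?_
      simp only [sum_range_consSeq, sub_le_iff_le_add']
      rw [sub_sub_eq_add_sub, add_comm x]

/-- Every event time contains the first gap, so moving the origin to `s` alters only that gap. The
extra delay `d` serves the law of pairs. -/
lemma residual_consSeq_shift (s d x : ℝ) (g : ℕ → ℝ) :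
    residual (s + d) (consSeq x g) = residual d (consSeq (x - s) g) := by
  unfold residual
  refine iInf_congr fun r => ?_
  simp only [sum_range_consSeq]
  have h1 : x - s + ∑ i ∈ Finset.range r, g i = x + ∑ i ∈ Finset.range r, g i - s := by ring
  simp only [h1, le_sub_iff_add_le, sub_sub, add_comm d s]

lemma residual_consSeq_of_le {s x : ℝ} {g : ℕ → ℝ} (hx : s ≤ x) (hg : ∀ n, 0 ≤ g n) :
    residual s (consSeq x g) = ENNReal.ofReal (x - s) := by
  unfold residual
  refine le_antisymm ((iInf_le _ 0).trans ?_) (le_iInf fun r => ?_)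
  · simp [hx]
  · have h0 : 0 ≤ ∑ i ∈ Finset.range r, g i := Finset.sum_nonneg fun i _ => hg i
    rw [sum_range_consSeq, if_pos (by linarith)]
    exact ENNReal.ofReal_le_ofReal (by linarith)

variable {r : ℝ}

/-- Stationarity reduces to `s = 0`, where the residual time is almost surely the first gap. -/
lemma lintegral_residual (hr : 0 < r) [IsProbabilityMeasure (expMeasure r)] {s : ℝ} (hs : 0 ≤ s)
    {f : ENNReal → ENNReal} (hf : Measurable f) :
    ∫⁻ g, f (residual s g) ∂(iidSeq (expMeasure r)) =
      ∫⁻ x, f (ENNReal.ofReal x) ∂(expMeasure r) := by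
  have hm : ∀ s, Measurable (residual s) := fun s => measurable_residual.comp measurable_prodMk_left
  have h := map_eq_map_zero_of_cons hr measurable_residual
    (fun s x g _ h => residual_consSeq_of_lt h)
    (fun s x g _ _ => by simpa using residual_consSeq_shift s 0 x g) hs
  have hf0 : Measurable fun g => f (residual 0 g) := hf.comp (hm 0)
  rw [← lintegral_map hf (hm s), h, lintegral_map hf (hm 0), lintegral_iidSeq _ hf0]
  refine lintegral_congr_ae ?_
  filter_upwards [ae_pos_expMeasure r] with x hx
  have : ∫⁻ g, f (residual 0 (consSeq x g)) ∂(iidSeq (expMeasure r)) =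
      ∫⁻ _, f (ENNReal.ofReal x) ∂(iidSeq (expMeasure r)) := by
    refine lintegral_congr_ae ?_
    filter_upwards [ae_iidSeq (ae_pos_expMeasure r)] with g hg
    rw [residual_consSeq_of_le hx.le fun n => (hg n).le, sub_zero]
  rw [this]
  simp

/-- The residual time at time `d`, if the residual time at time `0` is `x` and the next gap is `y`. -/
noncomputable def laterResidual (d : ℝ) (p : ℝ × ℝ) : ENNReal :=
  if d ≤ p.1 then ENNReal.ofReal (p.1 - d) else ENNReal.ofReal p.2

lemma measurable_laterResidual (d : ℝ) : Measurable (laterResidual d) :=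
  Measurable.ite (measurableSet_le measurable_const measurable_fst)
    (measurable_fst.sub_const d).ennreal_ofReal measurable_snd.ennreal_ofReal

/-- The joint law of the residual times of a Poisson process at the times `s` and `s + d`. -/
theorem map_residual_pair (hr : 0 < r) [IsProbabilityMeasure (expMeasure r)] {s d : ℝ} (hs : 0 ≤ s)
    (hd : 0 ≤ d) :
    (iidSeq (expMeasure r)).map (fun g => (residual s g, residual (s + d) g)) =
      ((expMeasure r).prod (expMeasure r)).map
        (fun p => (ENNReal.ofReal p.1, laterResidual d p)) := by
  have hm : ∀ s, Measurable (residual s) := fun s => measurable_residual.comp measurable_prodMk_left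
  have hG : Measurable (Function.uncurry fun s g => (residual s g, residual (s + d) g)) :=
    measurable_residual.prodMk
      (measurable_residual.comp ((measurable_fst.add_const d).prodMk measurable_snd))
  have h := map_eq_map_zero_of_cons (G := fun s g => (residual s g, residual (s + d) g)) hr hG
    (fun s x g _ h => by
      rw [residual_consSeq_of_lt h, residual_consSeq_of_lt (by linarith : x < s + d),
        sub_add_eq_add_sub])
    (fun s x g _ _ => by
      have h1 := residual_consSeq_shift s 0 x g
      have h2 := residual_consSeq_shift s d x g
      rw [add_zero] at h1
      simp only [h1, h2, zero_add]) hs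
  rw [h]
  have hm0 : Measurable fun g => (residual 0 g, residual (0 + d) g) := (hm 0).prodMk (hm _)
  have hmx : Measurable fun p : ℝ × ℝ => (ENNReal.ofReal p.1, laterResidual d p) :=
    measurable_fst.ennreal_ofReal.prodMk (measurable_laterResidual d)
  refine Measure.ext_of_lintegral _ fun F hF => ?_
  have hF0 : Measurable fun g => F (residual 0 g, residual (0 + d) g) := hF.comp hm0
  have hFx : Measurable fun p : ℝ × ℝ => F (ENNReal.ofReal p.1, laterResidual d p) := hF.comp hmx
  rw [lintegral_map hF hm0, lintegral_map hF hmx, lintegral_iidSeq _ hF0,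
    lintegral_prod _ hFx.aemeasurable]
  refine lintegral_congr_ae ?_
  filter_upwards [ae_pos_expMeasure r] with x hx
  simp only [zero_add]
  -- If the first event is at or after `d`, the same event is pending at both instants. Otherwise
  -- the process restarts at `x`, and its residual time at `d - x` is a fresh exponential.
  by_cases hdx : d ≤ x
  · refine Eq.trans (b := F (ENNReal.ofReal x, ENNReal.ofReal (x - d))) ?_ ?_
    · refine (lintegral_congr_ae (g := fun _ => F (ENNReal.ofReal x, ENNReal.ofReal (x - d)))
        ?_).trans (by simp)
      filter_upwards [ae_iidSeq (ae_pos_expMeasure r)] with g hg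
      rw [residual_consSeq_of_le hx.le fun n => (hg n).le,
        residual_consSeq_of_le hdx fun n => (hg n).le, sub_zero]
    · simp [laterResidual, hdx]
  · rw [not_le] at hdx
    have h3 := lintegral_residual hr (s := d - x) (by linarith)
      (hF.comp (measurable_prodMk_left (x := ENNReal.ofReal x)))
    simp only [laterResidual, not_le.2 hdx, if_false]
    refine Eq.trans (lintegral_congr_ae ?_) h3
    filter_upwards [ae_iidSeq (ae_pos_expMeasure r)] with g hg
    simp only [Function.comp]
    rw [residual_consSeq_of_le hx.le fun n => (hg n).le, residual_consSeq_of_lt hdx, sub_zero]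

end Residual


/-! ### Mean and covariance bounds for the sojourn times. -/

section Sojourn

variable {ι : Type*} [Fintype ι]

/-- The time from `s` until `K` of the point processes with gaps `e i` have had an event. -/
noncomputable def sojourn (K : ℕ) (s : ℝ) (e : ι → ℕ → ℝ) : ENNReal :=
  orderStat K fun i => residual s (e i)

lemma measurable_sojourn (K : ℕ) :
    Measurable (Function.uncurry (sojourn K : ℝ → (ι → ℕ → ℝ) → ENNReal)) :=
  (measurable_orderStat K).comp (measurable_pi_lambda _ fun i =>
    measurable_residual.comp (measurable_fst.prodMk ((measurable_pi_apply i).comp measurable_snd)))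

lemma measurable_residual_right (s : ℝ) : Measurable (residual s) :=
  measurable_residual.comp measurable_prodMk_left

lemma integrable_exp_half_expMeasure {r : ℝ} (hr : 0 < r) :
    Integrable (fun x => Real.exp (r / 2 * x)) (expMeasure r) := by
  refine ⟨Measurable.aestronglyMeasurable (by fun_prop), ?_⟩
  rw [hasFiniteIntegral_iff_ofReal (ae_of_all _ fun x => (Real.exp_pos _).le),
    lintegral_expMeasure r (by fun_prop)]
  have h1 : IntegrableOn (fun x : ℝ => r * Real.exp (-(r / 2) * x)) (Set.Ici 0) :=
    ((integrableOn_Ici_iff_integrableOn_Ioi (by simp)).2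
      (integrableOn_exp_mul_Ioi (by linarith : -(r / 2) < 0) 0)).const_mul _
  have h2 := (hasFiniteIntegral_iff_ofReal (ae_of_all _ fun x => by positivity)).1 h1.2
  refine lt_of_eq_of_lt (lintegral_congr fun x => ?_) h2
  rw [← ENNReal.ofReal_mul (by positivity), mul_assoc, ← Real.exp_add]
  congr 3
  ring

variable {r : ℝ} [IsProbabilityMeasure (expMeasure r)]

lemma map_residual (hr : 0 < r) {s : ℝ} (hs : 0 ≤ s) :
    (iidSeq (expMeasure r)).map (residual s) = (expMeasure r).map ENNReal.ofReal := by
  refine Measure.ext_of_lintegral _ fun f hf => ?_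
  rw [lintegral_map hf (measurable_residual_right s), lintegral_map hf ENNReal.measurable_ofReal,
    lintegral_residual hr hs hf]

lemma lintegral_sojourn (hr : 0 < r) {K : ℕ} (hK : K ≤ Fintype.card ι) {s : ℝ} (hs : 0 ≤ s) :
    ∫⁻ e, sojourn K s e ∂(Measure.pi fun _ : ι => iidSeq (expMeasure r)) =
      ENNReal.ofReal (orderStatMean r (Fintype.card ι) K) := by
  have h1 := lintegral_orderStat (ι := ι) hr hK
  have h2 : (Measure.pi fun _ : ι => iidSeq (expMeasure r)).map (fun e i => residual s (e i)) =
      (Measure.pi fun _ : ι => expMeasure r).map (fun x i => ENNReal.ofReal (x i)) := by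
    rw [Measure.pi_map_pi fun _ => (measurable_residual_right s).aemeasurable,
      Measure.pi_map_pi fun _ => ENNReal.measurable_ofReal.aemeasurable]
    simp_rw [map_residual hr hs]
  rw [← h1, ← lintegral_map (measurable_orderStat K) (by fun_prop), ← h2,
    lintegral_map (measurable_orderStat K)]
  · rfl
  · exact measurable_pi_lambda _ fun i => (measurable_residual_right s).comp (measurable_pi_apply i)

/-- Bound `w * w` by a multiple of `exp (γ w) = exp (2 γ w) exp (-γ w)`, then use `d ≤ w`: part of
the exponential moment is traded for decay in `d`. -/
lemma sq_le_exp_mul_exp {γ d w : ℝ} (hγ : 0 < γ) (hd : d ≤ w) (hw : 0 ≤ w) :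
    w * w ≤ 2 / γ ^ 2 * Real.exp (2 * γ * w) * Real.exp (-(γ * d)) := by
  have h1 := Real.quadratic_le_exp_of_nonneg (mul_nonneg hγ.le hw)
  have h2 : w * w ≤ 2 / γ ^ 2 * Real.exp (γ * w) := by
    rw [div_mul_eq_mul_div, le_div_iff₀ (by positivity)]
    nlinarith [mul_nonneg hγ.le hw]
  refine h2.trans ?_
  rw [mul_assoc, ← Real.exp_add]
  refine mul_le_mul_of_nonneg_left (Real.exp_le_exp.2 ?_) (by positivity)
  nlinarith [mul_le_mul_of_nonneg_left hd hγ.le]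

/-- If every first residual is below `d`, all later residuals are the fresh values and the first
summand suffices. Otherwise the total `w` of all values is at least `d`, and the product is at most
`w * w`, which `sq_le_exp_mul_exp` absorbs into the error term. -/
lemma orderStat_mul_le {K : ℕ} (hK : K ≤ Fintype.card ι) {γ : ℝ} (hγ : 0 < γ) {d : ℝ} (hd : 0 ≤ d)
    {p : ι → ℝ × ℝ} (hp : ∀ i, 0 < (p i).1 ∧ 0 < (p i).2) :
    orderStat K (fun i => ENNReal.ofReal (p i).1) * orderStat K (fun i => laterResidual d (p i)) ≤
      orderStat K (fun i => ENNReal.ofReal (p i).1) * orderStat K (fun i => ENNReal.ofReal (p i).2) +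
      ENNReal.ofReal (2 / γ ^ 2 * ∏ i, (Real.exp (2 * γ * (p i).1) * Real.exp (2 * γ * (p i).2))) *
        ENNReal.ofReal (Real.exp (-(γ * d))) := by
  by_cases hall : ∀ i, (p i).1 < d
  · refine le_add_right (mul_le_mul_right (orderStat_mono K fun i => ?_) _)
    simp [laterResidual, not_le.2 (hall i)]
  · push Not at hall
    obtain ⟨i, hi⟩ := hall
    set w : ℝ := ∑ i, ((p i).1 + (p i).2) with hw
    have hpos : ∀ i, 0 ≤ (p i).1 + (p i).2 := fun i => (add_pos (hp i).1 (hp i).2).le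
    have hw0 : 0 ≤ w := Finset.sum_nonneg fun i _ => hpos i
    have hdw : d ≤ w := hi.trans (by
      have := Finset.single_le_sum (f := fun i => (p i).1 + (p i).2) (fun i _ => hpos i)
        (Finset.mem_univ i)
      linarith [(hp i).2])
    have hle : ∀ z : ι → ENNReal, (∀ i, z i ≤ ENNReal.ofReal ((p i).1 + (p i).2)) →
        orderStat K z ≤ ENNReal.ofReal w := fun z hz => by
      refine (orderStat_le_sum hK z).trans ?_
      rw [hw, ENNReal.ofReal_sum_of_nonneg fun i _ => hpos i]
      exact Finset.sum_le_sum fun i _ => hz i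
    have h1 := hle (fun i => ENNReal.ofReal (p i).1) fun i =>
      ENNReal.ofReal_le_ofReal (by linarith [(hp i).2])
    have h2 := hle (fun i => laterResidual d (p i)) fun i => by
      unfold laterResidual
      split_ifs
      · exact ENNReal.ofReal_le_ofReal (by linarith [(hp i).2])
      · exact ENNReal.ofReal_le_ofReal (by linarith [(hp i).1])
    refine (mul_le_mul' h1 h2).trans (le_add_left ?_)
    have h3 : ∏ i, (Real.exp (2 * γ * (p i).1) * Real.exp (2 * γ * (p i).2)) =
        Real.exp (2 * γ * w) := by
      rw [hw, Finset.mul_sum, Real.exp_sum]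
      exact Finset.prod_congr rfl fun i _ => by rw [← Real.exp_add, mul_add]
    rw [h3, ← ENNReal.ofReal_mul hw0, ← ENNReal.ofReal_mul (by positivity)]
    exact ENNReal.ofReal_le_ofReal (sq_le_exp_mul_exp hγ hdw hw0)

/-- Integrate `orderStat_mul_le` with `γ = r / 4`. The constant `C` is the mean of its error factor,
finite because only exponential moments of order `2 γ = r / 2 < r` occur. -/
lemma exists_lintegral_sojourn_mul_le (ι : Type*) [Fintype ι] (hr : 0 < r) {K : ℕ}
    (hK : K ≤ Fintype.card ι) :
    ∃ C : ENNReal, C ≠ ⊤ ∧ ∀ s d : ℝ, 0 ≤ s → 0 ≤ d →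
      ∫⁻ e, sojourn K s e * sojourn K (s + d) e ∂(Measure.pi fun _ : ι => iidSeq (expMeasure r)) ≤
        ENNReal.ofReal (orderStatMean r (Fintype.card ι) K) ^ 2 +
          C * ENNReal.ofReal (Real.exp (-(r / 4 * d))) := by
  set ν := expMeasure r with hν
  set M : Measure (ι → ℝ × ℝ) := Measure.pi fun _ : ι => ν.prod ν with hM
  set B : (ι → ℝ × ℝ) → ℝ := fun p => 2 / (r / 4) ^ 2 *
    ∏ i, (Real.exp (2 * (r / 4) * (p i).1) * Real.exp (2 * (r / 4) * (p i).2)) with hB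
  have hBm : Measurable B := by
    refine Measurable.const_mul (Finset.measurable_fun_prod _ fun i _ => ?_) _
    exact ((measurable_pi_apply i).fst.const_mul _).exp.mul
      ((measurable_pi_apply i).snd.const_mul _).exp
  refine ⟨∫⁻ p, ENNReal.ofReal (B p) ∂M, ?_, fun s d hs hd => ?_⟩
  · have h1 : Integrable B M := by
      have h2 : Integrable (fun x => Real.exp (2 * (r / 4) * x)) ν := by
        have := integrable_exp_half_expMeasure hr
        refine this.congr (ae_of_all _ fun x => ?_)
        show Real.exp (r / 2 * x) = Real.exp (2 * (r / 4) * x)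
        congr 1
        ring
      have h3 : Integrable (fun q : ℝ × ℝ =>
          Real.exp (2 * (r / 4) * q.1) * Real.exp (2 * (r / 4) * q.2)) (ν.prod ν) := h2.mul_prod h2
      exact (Integrable.fintype_prod (f := fun _ : ι => fun q : ℝ × ℝ =>
          Real.exp (2 * (r / 4) * q.1) * Real.exp (2 * (r / 4) * q.2)) fun _ => h3).const_mul _
    exact h1.lintegral_lt_top.ne
  · have hpair : Measurable fun g => (residual s g, residual (s + d) g) :=
      (measurable_residual_right s).prodMk (measurable_residual_right _)
    have hpair' : Measurable fun p : ℝ × ℝ => (ENNReal.ofReal p.1, laterResidual d p) :=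
      measurable_fst.ennreal_ofReal.prodMk (measurable_laterResidual d)
    have h1 : (Measure.pi fun _ : ι => iidSeq ν).map
        (fun e i => (residual s (e i), residual (s + d) (e i))) =
        M.map (fun p i => (ENNReal.ofReal (p i).1, laterResidual d (p i))) := by
      rw [Measure.pi_map_pi (f := fun _ g => (residual s g, residual (s + d) g))
        fun _ => hpair.aemeasurable, hM, Measure.pi_map_pi (f := fun _ p =>
          (ENNReal.ofReal p.1, laterResidual d p)) fun _ => hpair'.aemeasurable]
      exact congrArg (fun m => Measure.pi fun _ : ι => m) (map_residual_pair hr hs hd)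
    set F : (ι → ENNReal × ENNReal) → ENNReal := fun z =>
      orderStat K (fun i => (z i).1) * orderStat K (fun i => (z i).2)
    have hF : Measurable F :=
      ((measurable_orderStat K).comp (measurable_pi_lambda _ fun i => (measurable_pi_apply i).fst)).mul
        ((measurable_orderStat K).comp (measurable_pi_lambda _ fun i => (measurable_pi_apply i).snd))
    have h2 : ∫⁻ e, sojourn K s e * sojourn K (s + d) e ∂(Measure.pi fun _ : ι => iidSeq ν) =
        ∫⁻ p, orderStat K (fun i => ENNReal.ofReal (p i).1) *
          orderStat K (fun i => laterResidual d (p i)) ∂M := by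
      have h3 := lintegral_map (μ := Measure.pi fun _ : ι => iidSeq ν) hF
        (measurable_pi_lambda _ fun i => hpair.comp (measurable_pi_apply i))
      have h4 := lintegral_map (μ := M) hF
        (measurable_pi_lambda _ fun i => hpair'.comp (measurable_pi_apply i))
      exact h3.symm.trans ((congrArg (fun m => ∫⁻ z, F z ∂m) h1).trans h4)
    rw [h2]
    have hpos : ∀ᵐ p ∂M, ∀ i, 0 < (p i).1 ∧ 0 < (p i).2 := by
      refine ae_all_iff.2 fun i => ?_
      have h5 : ∀ᵐ q ∂(ν.prod ν), 0 < q.1 ∧ 0 < q.2 :=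
        (Measure.quasiMeasurePreserving_fst.ae (ae_pos_expMeasure r)).and
          (Measure.quasiMeasurePreserving_snd.ae (ae_pos_expMeasure r))
      exact (measurePreserving_eval (fun _ : ι => ν.prod ν) i).quasiMeasurePreserving.ae h5
    refine (lintegral_mono_ae (hpos.mono fun p hp =>
      orderStat_mul_le hK (by positivity : 0 < r / 4) hd hp)).trans ?_
    have hm0 : Measurable fun x : ι → ℝ => orderStat K fun i => ENNReal.ofReal (x i) :=
      (measurable_orderStat K).comp (measurable_pi_lambda _ fun i =>
        (measurable_pi_apply i).ennreal_ofReal)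
    have hm2 : Measurable fun q : (ι → ℝ) × (ι → ℝ) => orderStat K (fun i => ENNReal.ofReal (q.1 i)) *
        orderStat K (fun i => ENNReal.ofReal (q.2 i)) :=
      (hm0.comp measurable_fst).mul (hm0.comp measurable_snd)
    rw [lintegral_add_right _ (hBm.ennreal_ofReal.mul_const _),
      lintegral_mul_const _ hBm.ennreal_ofReal]
    refine add_le_add (le_of_eq ?_) le_rfl
    have h6 := (measurePreserving_arrowProdEquivProdArrow ℝ ℝ ι (fun _ => ν)
      (fun _ => ν)).lintegral_comp hm2
    refine h6.trans ?_
    rw [lintegral_prod_mul hm0.aemeasurable hm0.aemeasurable, lintegral_orderStat hr hK, sq]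

end Sojourn

/-! ### The strong law for sojourn times at renewal epochs. -/

section Averages

lemma lintegral_exp_neg_lt_one {ν : Measure ℝ} [IsProbabilityMeasure ν]
    (hν : ∀ᵐ x ∂ν, 0 < x) {γ : ℝ} (hγ : 0 < γ) :
    ∫⁻ x, ENNReal.ofReal (Real.exp (-(γ * x))) ∂ν < 1 := by
  have hle : ∀ᵐ x ∂ν, ENNReal.ofReal (Real.exp (-(γ * x))) < 1 := by
    filter_upwards [hν] with x hx
    rw [ENNReal.ofReal_lt_one, Real.exp_lt_one_iff]
    have := mul_pos hγ hx
    linarith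
  have hfin : ∫⁻ x, ENNReal.ofReal (Real.exp (-(γ * x))) ∂ν ≠ ⊤ := by
    refine ne_top_of_le_ne_top ENNReal.one_ne_top ((lintegral_mono_ae (hle.mono fun _ => le_of_lt)).trans ?_)
    simp
  have := lintegral_strict_mono (IsProbabilityMeasure.ne_zero _) aemeasurable_const hfin hle
  simpa using this

lemma lintegral_exp_neg_sum_iidSeq (ν : Measure ℝ) [IsProbabilityMeasure ν] (γ : ℝ) (s : Finset ℕ) :
    ∫⁻ a, ENNReal.ofReal (Real.exp (-(γ * ∑ i ∈ s, a i))) ∂(iidSeq ν) =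
      (∫⁻ x, ENNReal.ofReal (Real.exp (-(γ * x))) ∂ν) ^ s.card := by
  have hm : Measurable fun x : ℝ => ENNReal.ofReal (Real.exp (-(γ * x))) := by fun_prop
  have h1 : ∀ a : ℕ → ℝ, ENNReal.ofReal (Real.exp (-(γ * ∑ i ∈ s, a i))) =
      ∏ i ∈ s, ENNReal.ofReal (Real.exp (-(γ * a i))) := by
    intro a
    rw [← ENNReal.ofReal_prod_of_nonneg fun i _ => (Real.exp_pos _).le, ← Real.exp_sum,
      Finset.mul_sum, Finset.sum_neg_distrib]
  simp_rw [h1]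
  have hind : iIndepFun (fun (i : ℕ) (a : ℕ → ℝ) => ENNReal.ofReal (Real.exp (-(γ * a i))))
      (iidSeq ν) := iIndepFun_infinitePi (P := fun _ : ℕ => ν)
        (X := fun _ x => ENNReal.ofReal (Real.exp (-(γ * x)))) fun _ => hm
  rw [lintegral_prod_eq_prod_lintegral_of_indepFun s _ hind fun i => hm.comp (measurable_pi_apply i)]
  rw [Finset.prod_congr rfl fun i _ => (measurePreserving_eval_infinitePi
    (fun _ : ℕ => ν) i).lintegral_comp hm, Finset.prod_const]

/-- The law of the gaps of a renewal process with interarrival law `ν` and of a family, indexed by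
`ι`, of renewal processes with interarrival law `ν'`, all of which are independent. -/
noncomputable abbrev gapLaw (ι : Type*) [Fintype ι] (ν ν' : Measure ℝ) [IsProbabilityMeasure ν]
    [IsProbabilityMeasure ν'] : Measure ((ℕ → ℝ) × (ι → ℕ → ℝ)) :=
  (iidSeq ν).prod (Measure.pi fun _ : ι => iidSeq ν')

variable {ι : Type*} [Fintype ι] {ν : Measure ℝ} [IsProbabilityMeasure ν] {r : ℝ}
  [IsProbabilityMeasure (expMeasure r)]

lemma measurable_sojourn_sum (K l : ℕ) : Measurable fun p : (ℕ → ℝ) × (ι → ℕ → ℝ) =>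
    sojourn K (∑ i ∈ Finset.range l, p.1 i) p.2 := by
  have hT : Measurable fun a : ℕ → ℝ => ∑ i ∈ Finset.range l, a i :=
    Finset.measurable_fun_sum _ fun i _ => measurable_pi_apply i
  have h1 : Measurable fun p : (ℕ → ℝ) × (ι → ℕ → ℝ) => (∑ i ∈ Finset.range l, p.1 i, p.2) :=
    (hT.comp measurable_fst).prodMk measurable_snd
  have h2 := (measurable_sojourn (ι := ι) K).comp h1
  exact h2

/-- The edges are independent of the arrivals, and for any fixed arrival time the mean sojourn is
the same. -/
lemma lintegral_sojourn_sum (hν : ∀ᵐ x ∂ν, 0 < x) (hr : 0 < r) {K : ℕ} (hK : K ≤ Fintype.card ι)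
    (l : ℕ) : ∫⁻ p, sojourn K (∑ i ∈ Finset.range l, p.1 i) p.2 ∂(gapLaw ι ν (expMeasure r)) =
      ENNReal.ofReal (orderStatMean r (Fintype.card ι) K) := by
  set c := orderStatMean r (Fintype.card ι) K with hc
  rw [lintegral_prod _ (measurable_sojourn_sum K l).aemeasurable]
  refine (lintegral_congr_ae (g := fun _ => ENNReal.ofReal c) ?_).trans (by simp)
  filter_upwards [ae_iidSeq hν] with a ha
  have h1 := lintegral_sojourn (ι := ι) hr hK (s := ∑ i ∈ Finset.range l, a i)
    (Finset.sum_nonneg fun i _ => (ha i).le)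
  exact h1

lemma ae_sojourn_sum_lt_top (hν : ∀ᵐ x ∂ν, 0 < x) (hr : 0 < r) {K : ℕ} (hK : K ≤ Fintype.card ι) :
    ∀ᵐ p ∂(gapLaw ι ν (expMeasure r)), ∀ l,
      sojourn K (∑ i ∈ Finset.range l, p.1 i) p.2 < ⊤ :=
  ae_all_iff.2 fun l => ae_lt_top (measurable_sojourn_sum K l)
    (by rw [lintegral_sojourn_sum hν hr hK]; exact ENNReal.ofReal_ne_top)

/-- The strong law of large numbers for the times from the events of a renewal process until `K` of
finitely many Poisson processes have had an event. -/
theorem ae_tendsto_average_sojourn (hν : ∀ᵐ x ∂ν, 0 < x) (hr : 0 < r) {K : ℕ} (hK : K ≤ Fintype.card ι) :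
    ∀ᵐ p ∂(gapLaw ι ν (expMeasure r)), Tendsto (fun n : ℕ => (∑ l ∈ Finset.range n,
      (sojourn K (∑ i ∈ Finset.range (l + 1), p.1 i) p.2).toReal) / n) atTop
      (𝓝 (orderStatMean r (Fintype.card ι) K)) := by
  set c := orderStatMean r (Fintype.card ι) K with hc
  have hc0 : 0 ≤ c := orderStatMean_nonneg hr hK
  set X : ℕ → (ℕ → ℝ) × (ι → ℕ → ℝ) → ENNReal :=
    fun l p => sojourn K (∑ i ∈ Finset.range (l + 1), p.1 i) p.2 with hX
  have hXm : ∀ l, Measurable (X l) := fun l => measurable_sojourn_sum K (l + 1)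
  have hpos : ∀ᵐ a ∂(iidSeq ν), ∀ n, 0 < a n := ae_iidSeq hν
  have hmean : ∀ l, ∫⁻ p, X l p ∂(gapLaw ι ν (expMeasure r)) = ENNReal.ofReal c := fun l =>
    lintegral_sojourn_sum hν hr hK (l + 1)
  obtain ⟨C, hC, hCle⟩ := exists_lintegral_sojourn_mul_le ι hr hK
  -- Averaging `exp (-(r / 4) d)` over the `j - i` independent gaps separating two arrivals gives `ρ
  -- ^ (j - i)`.
  set ρ := ∫⁻ x, ENNReal.ofReal (Real.exp (-(r / 4 * x))) ∂ν with hρ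
  have hρ1 : ρ < 1 := lintegral_exp_neg_lt_one hν (by positivity)
  have hcov : ∀ i j, i ≤ j → ∫⁻ p, X i p * X j p ∂(gapLaw ι ν (expMeasure r)) ≤
      ENNReal.ofReal (c ^ 2 + C.toReal * ρ.toReal ^ (j - i)) := by
    intro i j hij
    have hXX : Measurable fun p => X i p * X j p := (hXm i).mul (hXm j)
    rw [lintegral_prod _ hXX.aemeasurable]
    have h1 : ∀ᵐ a ∂(iidSeq ν),
        ∫⁻ e, X i (a, e) * X j (a, e) ∂(Measure.pi fun _ : ι => iidSeq (expMeasure r)) ≤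
        ENNReal.ofReal c ^ 2 + C * ENNReal.ofReal
          (Real.exp (-(r / 4 * ∑ k ∈ Finset.Ico (i + 1) (j + 1), a k))) := by
      filter_upwards [hpos] with a ha
      have h2 := hCle (∑ k ∈ Finset.range (i + 1), a k) (∑ k ∈ Finset.Ico (i + 1) (j + 1), a k)
        (Finset.sum_nonneg fun i _ => (ha i).le) (Finset.sum_nonneg fun i _ => (ha i).le)
      rwa [Finset.sum_range_add_sum_Ico _ (by omega : i + 1 ≤ j + 1)] at h2
    refine (lintegral_mono_ae h1).trans (le_of_eq ?_)
    have hm : Measurable fun a : ℕ → ℝ => ENNReal.ofReal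
        (Real.exp (-(r / 4 * ∑ k ∈ Finset.Ico (i + 1) (j + 1), a k))) := by
      fun_prop
    rw [lintegral_add_left measurable_const, lintegral_const_mul _ hm, lintegral_exp_neg_sum_iidSeq,
      ← hρ, Nat.card_Ico, Nat.add_sub_add_right, ENNReal.ofReal_add (by positivity) (by positivity),
      ENNReal.ofReal_mul ENNReal.toReal_nonneg, ENNReal.ofReal_toReal hC,
      ENNReal.ofReal_pow ENNReal.toReal_nonneg, ENNReal.ofReal_toReal hρ1.ne_top,
      ENNReal.ofReal_pow hc0]
    simp
  have hfin : ∀ l, ∀ᵐ p ∂(gapLaw ι ν (expMeasure r)), X l p < ⊤ := fun l =>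
    (ae_sojourn_sum_lt_top hν hr hK).mono fun p hp => hp (l + 1)
  have hprod : ∀ i j, ∫⁻ p, ENNReal.ofReal ((X i p).toReal * (X j p).toReal) ∂(gapLaw ι ν (expMeasure r)) =
      ∫⁻ p, X i p * X j p ∂(gapLaw ι ν (expMeasure r)) := by
    intro i j
    refine lintegral_congr_ae ?_
    filter_upwards [hfin i, hfin j] with p h1 h2
    rw [ENNReal.ofReal_mul ENNReal.toReal_nonneg, ENNReal.ofReal_toReal h1.ne,
      ENNReal.ofReal_toReal h2.ne]
  refine ae_tendsto_average_of_covariance_le (Y := fun l p => (X l p).toReal) (C := C.toReal)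
    (ρ := ρ.toReal) (fun l => ?_) (fun _ _ => ENNReal.toReal_nonneg) ENNReal.toReal_nonneg
    ENNReal.toReal_nonneg ?_ (fun l => ?_) fun i j hij => ?_
  · rw [memLp_two_iff_integrable_sq (hXm l).ennreal_toReal.aestronglyMeasurable]
    refine ⟨((hXm l).ennreal_toReal.pow_const 2).aestronglyMeasurable, ?_⟩
    rw [hasFiniteIntegral_iff_ofReal (ae_of_all _ fun _ => sq_nonneg _)]
    simp_rw [sq]
    rw [hprod]
    exact (hcov l l le_rfl).trans_lt ENNReal.ofReal_lt_top
  · exact ENNReal.toReal_lt_of_lt_ofReal (by simpa using hρ1)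
  · rw [integral_toReal (hXm l).aemeasurable (hfin l), hmean, ENNReal.toReal_ofReal hc0]
  · rw [integral_eq_lintegral_of_nonneg_ae
      (ae_of_all _ fun _ => mul_nonneg ENNReal.toReal_nonneg ENNReal.toReal_nonneg)
      ((hXm i).ennreal_toReal.mul (hXm j).ennreal_toReal).aestronglyMeasurable, hprod]
    exact ENNReal.toReal_le_of_le_ofReal (by positivity) (hcov i j hij)

end Averages


/-! ### Joint law of the source and edge clocks. -/

section GapLaw

/-- The joint law of independent sequences of independent random variables. -/
lemma map_eq_gapLaw {ι : Type*} [Fintype ι] {Ω : Type*} [MeasurableSpace Ω] {P : Measure Ω}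
    {ν ν' : Measure ℝ} [IsProbabilityMeasure ν] [IsProbabilityMeasure ν']
    {X : Option ι → ℕ → Ω → ℝ} (hX : ∀ c n, Measurable (X c n))
    (hind : iIndepFun (fun p : Option ι × ℕ => X p.1 p.2) P)
    (h0 : ∀ n, P.map (X none n) = ν) (h1 : ∀ i n, P.map (X (some i) n) = ν') :
    P.map (fun ω => ((fun n => X none n ω), fun i n => X (some i) n ω)) = gapLaw ι ν ν' := by
  set law : Option ι → Measure ℝ := fun c => c.elim ν fun _ => ν' with hlaw
  have hp : ∀ c, IsProbabilityMeasure (law c) := by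
    rintro (_ | i)
    · exact (inferInstance : IsProbabilityMeasure ν)
    · exact (inferInstance : IsProbabilityMeasure ν')
  have h2 : P.map (fun ω (p : Option ι × ℕ) => X p.1 p.2 ω) =
      Measure.infinitePi fun p : Option ι × ℕ => law p.1 := by
    have h3 := iIndepFun.map_fun_eq_infinitePi_map (fun p : Option ι × ℕ => hX p.1 p.2) hind
    rw [h3]
    congr 1
    ext1 ⟨c, n⟩
    cases c with
    | none => exact h0 n
    | some i => exact h1 i n
  have hm : Measurable fun ω (p : Option ι × ℕ) => X p.1 p.2 ω :=
    measurable_pi_lambda _ fun p => hX p.1 p.2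
  have h3 : P.map (fun ω c n => X c n ω) = Measure.pi fun c => iidSeq (law c) := by
    have h4 := Measure.infinitePi_map_curry (fun (c : Option ι) (_ : ℕ) => law c)
    rw [← h2, Measure.map_map (MeasurableEquiv.measurable _) hm, Measure.infinitePi_eq_pi] at h4
    exact h4
  have hsplit : Measurable fun f : Option ι → ℕ → ℝ => (f none, fun i => f (some i)) :=
    (measurable_pi_apply none).prodMk (measurable_pi_lambda _ fun i => measurable_pi_apply (some i))
  have h5 : P.map (fun ω => ((fun n => X none n ω), fun i n => X (some i) n ω)) =
      (P.map (fun ω c n => X c n ω)).map (fun f => (f none, fun i => f (some i))) := by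
    rw [Measure.map_map hsplit (measurable_pi_lambda _ fun c => measurable_pi_lambda _ fun n => hX c n)]
    rfl
  rw [h5, h3, ← Measure.pi_map_piOptionEquivProd,
    Measure.map_map hsplit (MeasurableEquiv.measurable _)]
  -- `piOptionEquivProd` places the `none` coordinate second, whereas `gapLaw` places the source
  -- first.
  exact Measure.prod_swap

end GapLaw

/-! ### Mean of the exponential law. -/

section Exponential

lemma integral_expMeasure {r : ℝ} (hr : 0 < r) :
    Integrable (fun x => x) (expMeasure r) ∧ ∫ x, x ∂(expMeasure r) = 1 / r := by
  have hnn : ∀ᵐ x ∂(expMeasure r), 0 ≤ x := (ae_pos_expMeasure r).mono fun _ => le_of_lt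
  have h1 : ∫⁻ x, ENNReal.ofReal x ∂(expMeasure r) = ENNReal.ofReal (1 / r) := by
    rw [lintegral_eq_lintegral_meas_lt _ hnn aemeasurable_id']
    have h2 : ∀ t ∈ Set.Ioi (0 : ℝ), expMeasure r {x | t < x} =
        ENNReal.ofReal (Real.exp (-r * t)) := by
      intro t ht
      rw [neg_mul]
      exact expMeasure_Ioi hr (le_of_lt ht)
    rw [setLIntegral_congr_fun measurableSet_Ioi h2, ← ofReal_integral_eq_lintegral_ofReal
      (integrableOn_exp_mul_Ioi (neg_lt_zero.2 hr) 0) (ae_of_all _ fun _ => (Real.exp_pos _).le),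
      integral_exp_mul_Ioi (neg_lt_zero.2 hr)]
    simp
  refine ⟨⟨aestronglyMeasurable_id, ?_⟩, ?_⟩
  · rw [hasFiniteIntegral_iff_ofReal hnn, h1]
    exact ENNReal.ofReal_lt_top
  · rw [integral_eq_lintegral_of_nonneg_ae hnn aestronglyMeasurable_id, h1,
      ENNReal.toReal_ofReal (by positivity)]

end Exponential

/-! ### Sample-path properties of residual and sojourn times. -/

section Paths

lemma residual_le_add {s s' : ℝ} (h : s ≤ s') (g : ℕ → ℝ) :
    residual s g ≤ ENNReal.ofReal (s' - s) + residual s' g := by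
  unfold residual
  rw [ENNReal.add_iInf]
  refine le_iInf fun r => (iInf_le _ r).trans ?_
  by_cases h1 : s' ≤ ∑ i ∈ Finset.range (r + 1), g i
  · rw [if_pos h1, if_pos (h.trans h1), ← ENNReal.ofReal_add (by linarith) (by linarith)]
    exact ENNReal.ofReal_le_ofReal (by linarith)
  · simp [h1]

/-- The time of the first event after `s` is at most `t`. -/
lemma residual_le_iff {s t : ℝ} (hs : 0 < s) {g : ℕ → ℝ} (hg : ∀ n, 0 ≤ g n) :
    (s ≤ t ∧ residual s g ≤ ENNReal.ofReal (t - s)) ↔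
      ∃ r : ℕ, 1 ≤ r ∧ ∑ i ∈ Finset.range r, g i ≤ t ∧ ∑ i ∈ Finset.range (r - 1), g i < s ∧
        s ≤ ∑ i ∈ Finset.range r, g i := by
  classical
  have hmono : Monotone fun r => ∑ i ∈ Finset.range r, g i := fun a b hab =>
    Finset.sum_le_sum_of_subset_of_nonneg (Finset.range_mono hab) fun i _ _ => hg i
  constructor
  · rintro ⟨hst, h⟩
    have hex : ∃ r, s ≤ ∑ i ∈ Finset.range (r + 1), g i := by
      by_contra! hno
      have : residual s g = ⊤ := by
        unfold residual
        simp [not_le.2 (hno _)]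
      rw [this] at h
      exact absurd h (by simp)
    have hspec := Nat.find_spec hex
    refine ⟨Nat.find hex + 1, by omega, ?_, ?_, hspec⟩
    · have h2 : ENNReal.ofReal (∑ i ∈ Finset.range (Nat.find hex + 1), g i - s) ≤ residual s g := by
        refine le_iInf fun r => ?_
        split_ifs with hr
        · exact ENNReal.ofReal_le_ofReal (sub_le_sub_right
            (hmono (Nat.succ_le_succ (Nat.find_min' hex hr))) _)
        · exact le_top
      have h3 := (ENNReal.ofReal_le_ofReal_iff (by linarith)).1 (h2.trans h)
      linarith
    · rw [Nat.add_sub_cancel]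
      -- For the first activation the preceding one is the time origin, which lies strictly before
      -- `s` because `0 < s`.
      rcases Nat.eq_zero_or_pos (Nat.find hex) with h0 | h0
      · rw [h0]
        simpa using hs
      · have := Nat.find_min hex (m := Nat.find hex - 1) (by omega)
        rw [Nat.sub_add_cancel h0] at this
        exact not_le.1 this
  · rintro ⟨r, hr, h1, -, h2⟩
    refine ⟨h2.trans h1, (iInf_le _ (r - 1)).trans ?_⟩
    rw [Nat.sub_add_cancel hr, if_pos h2]
    exact ENNReal.ofReal_le_ofReal (by linarith)

variable {ι : Type*} [Fintype ι]

lemma add_sojourn_le_iff {K : ℕ} {s t : ℝ} {e : ι → ℕ → ℝ} (h : sojourn K s e < ⊤) :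
    s + (sojourn K s e).toReal ≤ t ↔
      s ≤ t ∧ K ≤ (Finset.univ.filter fun i => residual s (e i) ≤ ENNReal.ofReal (t - s)).card := by
  rw [← orderStat_le_iff ENNReal.ofReal_lt_top]
  constructor
  · intro h1
    have h2 : s ≤ t := le_trans (le_add_of_nonneg_right ENNReal.toReal_nonneg) h1
    exact ⟨h2, (ENNReal.le_ofReal_iff_toReal_le h.ne (by linarith)).2 (by linarith)⟩
  · rintro ⟨h1, h2⟩
    have := (ENNReal.le_ofReal_iff_toReal_le h.ne (by linarith)).1 h2
    linarith

/-- On every edge an older key arrives no later than a newer one, so `K` of them do too. Versions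
thus become decryptable in order. -/
lemma add_sojourn_mono {K : ℕ} {s s' : ℝ} {e : ι → ℕ → ℝ} (hs : s ≤ s') (h : sojourn K s e < ⊤)
    (h' : sojourn K s' e < ⊤) :
    s + (sojourn K s e).toReal ≤ s' + (sojourn K s' e).toReal := by
  obtain ⟨h1, h2⟩ := (add_sojourn_le_iff h').1 le_rfl
  refine (add_sojourn_le_iff h).2 ⟨hs.trans h1, h2.trans (Finset.card_le_card fun i hi => ?_)⟩
  simp only [Finset.mem_filter, Finset.mem_univ, true_and] at hi ⊢
  refine (residual_le_add hs _).trans ((add_le_add le_rfl hi).trans ?_)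
  rw [← ENNReal.ofReal_add (by linarith) (by linarith)]
  exact ENNReal.ofReal_le_ofReal (by linarith)

end Paths

/-! ### From the gossip network to the queue. -/

namespace Clocks

variable {m : ℕ} {lamS lamE : ℝ} {Ω : Type*} [MeasurableSpace Ω] {P : Measure Ω}

/-- The edge to `j` from an element of `S` other than `j`. -/
def edgeTo (S : Finset (Fin m)) (j : Fin m) (i : ↥(S.erase j)) :
    {e : Fin m × Fin m // e.1 ≠ e.2} :=
  ⟨(i, j), Finset.ne_of_mem_erase i.2⟩

lemma edgeTo_injective (S : Finset (Fin m)) (j : Fin m) :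
    Function.Injective (edgeTo S j) := fun _ _ h => by
  have := congrArg (fun e : {e : Fin m × Fin m // e.1 ≠ e.2} => e.1.1) h
  exact Subtype.ext this

/-- The gaps of the clock of the source and of the clocks of the edges from other elements of `S` to
`j`. -/
def gapsTo (N : Clocks m lamS lamE P) (S : Finset (Fin m)) (j : Fin m) (ω : Ω) :
    (ℕ → ℝ) × (↥(S.erase j) → ℕ → ℝ) :=
  ((fun n => N.gap none n ω), fun i n => N.gap (some (edgeTo S j i)) n ω)

lemma measurable_gapsTo (N : Clocks m lamS lamE P) (S : Finset (Fin m)) (j : Fin m) :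
    Measurable (N.gapsTo S j) :=
  (measurable_pi_lambda _ fun n => N.measurable_gap none n).prodMk
    (measurable_pi_lambda _ fun _ => measurable_pi_lambda _ fun n => N.measurable_gap _ n)

lemma map_gapsTo (N : Clocks m lamS lamE P) (S : Finset (Fin m)) (j : Fin m) {ν ν' : Measure ℝ}
    [IsProbabilityMeasure ν] [IsProbabilityMeasure ν'] (hν : ν = expMeasure lamS)
    (hν' : ∀ i, expMeasure (rate m lamS lamE (some (edgeTo S j i))) = ν') :
    P.map (N.gapsTo S j) = gapLaw ↥(S.erase j) ν ν' := by
  set c : Option ↥(S.erase j) → Counter m := Option.map (edgeTo S j) with hc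
  have hinj : Function.Injective fun p : Option ↥(S.erase j) × ℕ => (c p.1, p.2) := by
    rintro ⟨a, n⟩ ⟨b, n'⟩ h
    rw [Prod.mk.injEq] at h
    exact Prod.ext (Option.map_injective (edgeTo_injective S j) h.1) h.2
  exact map_eq_gapLaw (X := fun a n => N.gap (c a) n) (fun a n => N.measurable_gap _ n)
    (N.indep_gap.precomp hinj) (fun n => by rw [hν]; exact N.law_gap none n)
    (fun i n => (N.law_gap _ n).trans (hν' i))

/-- The number of keys that a node has to receive from other nodes in order to decrypt. -/
lemma le_ncard_keys_iff (N : Clocks m lamS lamE P) (S : Finset (Fin m)) (k : ℕ) (j : Fin m)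
    (l : ℕ) (t : ℝ) (ω : Ω) [DecidablePred fun i => N.Sends (edgeTo S j i) l t ω] :
    k + 1 ≤ (N.keys S j l t ω).ncard ↔ N.updateTime l ω ≤ t ∧
      (if j ∈ S then k else k + 1) ≤
        (Finset.univ.filter fun i => N.Sends (edgeTo S j i) l t ω).card := by
  classical
  set F := (Finset.univ.filter fun i => N.Sends (edgeTo S j i) l t ω) with hF
  have hmemF : ∀ i, i ∈ F.map (Function.Embedding.subtype _) ↔
      i ∈ S ∧ ∃ h : i ≠ j, N.Sends ⟨(i, j), h⟩ l t ω := by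
    intro i
    simp only [hF, Finset.mem_map, Finset.mem_filter, Finset.mem_univ, true_and,
      Function.Embedding.coe_subtype]
    constructor
    · rintro ⟨a, ha, rfl⟩
      exact ⟨Finset.mem_of_mem_erase a.2, Finset.ne_of_mem_erase a.2, ha⟩
    · rintro ⟨hi, hij, hs⟩
      exact ⟨⟨i, Finset.mem_erase.2 ⟨hij, hi⟩⟩, hs, rfl⟩
  by_cases hl : N.updateTime l ω ≤ t
  · by_cases hj : j ∈ S
    · have h1 : N.keys S j l t ω = ↑(insert j (F.map (Function.Embedding.subtype _))) := by
        ext i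
        rw [Finset.mem_coe, Finset.mem_insert, hmemF]
        constructor
        · rintro ⟨hi, ⟨rfl, -⟩ | h⟩
          exacts [Or.inl rfl, Or.inr ⟨hi, h⟩]
        · rintro (rfl | ⟨hi, h⟩)
          exacts [⟨hj, Or.inl ⟨rfl, hl⟩⟩, ⟨hi, Or.inr h⟩]
      have h2 : j ∉ F.map (Function.Embedding.subtype _) := fun h =>
        ((hmemF j).1 h).2.1 rfl
      rw [h1, Set.ncard_coe_finset, Finset.card_insert_of_notMem h2, Finset.card_map]
      simp [hl, hj]
    · have h1 : N.keys S j l t ω = ↑(F.map (Function.Embedding.subtype _)) := by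
        ext i
        rw [Finset.mem_coe, hmemF]
        constructor
        · rintro ⟨hi, ⟨rfl, -⟩ | h⟩
          exacts [absurd hi hj, ⟨hi, h⟩]
        · rintro ⟨hi, h⟩
          exact ⟨hi, Or.inr h⟩
      rw [h1, Set.ncard_coe_finset, Finset.card_map]
      simp [hl, hj]
  · have h1 : N.keys S j l t ω = ∅ := by
      refine Set.eq_empty_of_forall_notMem ?_
      rintro i ⟨-, ⟨-, h⟩ | ⟨_, r, -, h2, -, h3⟩⟩
      exacts [hl h, hl (h3.trans h2)]
    rw [h1, Set.ncard_empty]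
    simp [hl]

/-- The time at which node `j` can decrypt version `l`, when `K` keys of other nodes are needed. -/
noncomputable def decryptTime (N : Clocks m lamS lamE P) (S : Finset (Fin m)) (j : Fin m) (K : ℕ)
    (ω : Ω) (l : ℕ) : ℝ :=
  N.updateTime l ω + (sojourn K (N.updateTime l ω) (N.gapsTo S j ω).2).toReal

/-- Since decryption times are monotone, the decryptable versions form an initial segment whose
maximum is its size; divergence keeps it bounded. -/
lemma nodeVersion_eq_count (N : Clocks m lamS lamE P) (S : Finset (Fin m)) (k : ℕ) (j : Fin m)
    {K : ℕ} (hK : K = if j ∈ S then k else k + 1) {ω : Ω} (hpos : ∀ n, 0 < N.gap none n ω)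
    (hpos' : ∀ i n, 0 < N.gap (some (edgeTo S j i)) n ω)
    (hfin : ∀ l, sojourn K (N.updateTime l ω) (N.gapsTo S j ω).2 < ⊤)
    (hmono : Monotone (N.decryptTime S j K ω))
    (htop : Tendsto (N.decryptTime S j K ω) atTop atTop) (t : ℝ) :
    N.nodeVersion S k j t ω = count (N.decryptTime S j K ω) t := by
  classical
  have h1 : ∀ l, 1 ≤ l → (k + 1 ≤ (N.keys S j l t ω).ncard ↔ N.decryptTime S j K ω l ≤ t) := by
    intro l hl
    have hτ : 0 < N.updateTime l ω :=
      Finset.sum_pos (fun i _ => hpos i) (Finset.nonempty_range_iff.2 (by omega))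
    rw [le_ncard_keys_iff, decryptTime, add_sojourn_le_iff (hfin l), ← hK]
    refine and_congr_right fun hlt => ?_
    -- The half-open window in `Sends` singles out the first activation at or after the update.
    have h2 : ∀ i, N.Sends (edgeTo S j i) l t ω ↔
        residual (N.updateTime l ω) ((N.gapsTo S j ω).2 i) ≤
          ENNReal.ofReal (t - N.updateTime l ω) := fun i => by
      have h3 := residual_le_iff (t := t) hτ (g := (N.gapsTo S j ω).2 i) fun n => (hpos' i n).le
      rw [and_iff_right hlt] at h3
      exact h3.symm
    simp only [h2]
  have h2 : {l : ℕ | l = 0 ∨ k + 1 ≤ (N.keys S j l t ω).ncard} =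
      Set.Iic (count (N.decryptTime S j K ω) t) := by
    ext l
    rcases Nat.eq_zero_or_pos l with rfl | hl
    · simp
    · rw [Set.mem_Iic, le_count_iff hmono htop hl, ← h1 l hl]
      simp [hl.ne']
  rw [nodeVersion, h2, csSup_Iic]

lemma ae_tendsto_updateTime_div (N : Clocks m lamS lamE P) (hS : 0 < lamS) :
    ∀ᵐ ω ∂P, Tendsto (fun l : ℕ => N.updateTime l ω / l) atTop (𝓝 (1 / lamS)) := by
  have hlaw : ∀ n, P.map (N.gap none n) = expMeasure lamS := N.law_gap none
  obtain ⟨hint, hmean⟩ := integral_expMeasure hS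
  have h1 : Integrable (N.gap none 0) P := by
    rw [← hlaw 0] at hint
    exact hint.comp_measurable (N.measurable_gap none 0)
  have h2 : ∫ ω, N.gap none 0 ω ∂P = 1 / lamS := by
    rw [← hmean, ← hlaw 0]
    exact (integral_map (N.measurable_gap none 0).aemeasurable aestronglyMeasurable_id).symm
  have h3 := strong_law_ae_real (fun n => N.gap none n) h1
    (fun a b hab => N.indep_gap.indepFun (i := (none, a)) (j := (none, b)) (by simpa using hab))
    (fun n => ⟨(N.measurable_gap none n).aemeasurable, (N.measurable_gap none 0).aemeasurable,
      (hlaw n).trans (hlaw 0).symm⟩)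
  rw [h2] at h3
  exact h3

/-- Little's law applied to almost every path. The rate `r` is tied only to edges into `j` from
other subscribers, so it is an arbitrary positive number when there are none. -/
lemma hasVersionAge (N : Clocks m lamS lamE P) (hS : 0 < lamS) (S : Finset (Fin m)) (k : ℕ)
    (j : Fin m) {r : ℝ} (hr : 0 < r) (hrate : ∀ i, rate m lamS lamE (some (edgeTo S j i)) = r)
    {K : ℕ} (hK : K = if j ∈ S then k else k + 1) (hKc : K ≤ (S.erase j).card) :
    N.HasVersionAge S k j (lamS * orderStatMean r (S.erase j).card K) := by
  obtain ⟨ν, hν⟩ : ∃ ν, ν = expMeasure lamS := ⟨_, rfl⟩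
  have : IsProbabilityMeasure ν := hν ▸ isProbabilityMeasure_expMeasure hS
  have := isProbabilityMeasure_expMeasure hr
  have hνpos : ∀ᵐ x ∂ν, 0 < x := hν ▸ ae_pos_expMeasure lamS
  have hcard : K ≤ Fintype.card ↥(S.erase j) := by rwa [Fintype.card_coe]
  have hlaw := N.map_gapsTo S j (ν' := expMeasure r) hν fun i => by rw [hrate i]
  have hpos : ∀ c, ∀ᵐ ω ∂P, ∀ n, 0 < N.gap c n ω := by
    intro c
    refine ae_all_iff.2 fun n => ae_of_ae_map (N.measurable_gap c n).aemeasurable ?_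
    rw [N.law_gap]
    exact ae_pos_expMeasure _
  have hfin := ae_of_ae_map (N.measurable_gapsTo S j).aemeasurable
    (hlaw ▸ ae_sojourn_sum_lt_top hνpos hr hcard)
  have havg := ae_of_ae_map (N.measurable_gapsTo S j).aemeasurable
    (hlaw ▸ ae_tendsto_average_sojourn hνpos hr hcard)
  have hpos' : ∀ᵐ ω ∂P, ∀ i n, 0 < N.gap (some (edgeTo S j i)) n ω :=
    ae_all_iff.2 fun i => hpos _
  filter_upwards [hpos none, hpos', hfin, havg, N.ae_tendsto_updateTime_div hS]
    with ω h0 h1 h2 h3 h4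
  have hc : 0 < 1 / lamS := by positivity
  set τ : ℕ → ℝ := fun l => N.updateTime l ω with hτ
  have hτm : Monotone τ := fun a b hab =>
    Finset.sum_le_sum_of_subset_of_nonneg (Finset.range_mono hab) fun i _ _ => (h0 i).le
  have hτpos : ∀ l, 1 ≤ l → 0 < τ l := fun l hl =>
    Finset.sum_pos (fun i _ => h0 i) (Finset.nonempty_range_iff.2 (by omega))
  have hDm : Monotone (N.decryptTime S j K ω) := fun a b hab =>
    add_sojourn_mono (hτm hab) (h2 a) (h2 b)
  have hτD : ∀ l, τ l ≤ N.decryptTime S j K ω l := fun l =>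
    le_add_of_nonneg_right ENNReal.toReal_nonneg
  have hDt : Tendsto (N.decryptTime S j K ω) atTop atTop :=
    tendsto_atTop_mono hτD (tendsto_atTop_of_tendsto_div hc h4)
  have hage : ∀ u, N.age S k j u ω =
      (count τ u : ℝ) - (count (N.decryptTime S j K ω) u : ℝ) := fun u => by
    rw [age, N.nodeVersion_eq_count S k j hK h0 h1 h2 hDm hDt]
    rfl
  rw [Fintype.card_coe] at h3
  obtain ⟨h5, h6⟩ := tendsto_average_count_sub_count hτm hDm hτD hτpos hc h4
    (h3.congr fun n => by
      congr 1
      refine Finset.sum_congr rfl fun l _ => ?_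
      rw [decryptTime, add_sub_cancel_left]
      rfl)
  simp_rw [hage]
  refine ⟨fun t _ => h5 t, ?_⟩
  rwa [one_div, inv_inv, mul_comm] at h6

end Clocks

/-! ### Explicit graph average and its limit. -/

section Limit

/-- Each of the `K` summands is `(m - 1) / (lamE (u m - j))` with `j` fixed, and tends to `1 / (α
lamE)`. -/
lemma tendsto_orderStatMean {lamE α : ℝ} (hE : 0 < lamE) (hα : 0 < α) {u : ℕ → ℕ}
    (hu : Tendsto (fun m : ℕ => (u m : ℝ) / m) atTop (𝓝 α)) (K : ℕ) :
    Tendsto (fun m : ℕ => orderStatMean (lamE / ((m : ℝ) - 1)) (u m) K) atTop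
      (𝓝 (K / (α * lamE))) := by
  have hc : ∀ c : ℝ, Tendsto (fun m : ℕ => c / (m : ℝ)) atTop (𝓝 0) := fun c =>
    tendsto_const_nhds.div_atTop tendsto_natCast_atTop_atTop
  have h1 : ∀ j ∈ Finset.range K, Tendsto
      (fun m : ℕ => 1 / (lamE / ((m : ℝ) - 1) * ((u m : ℝ) - j))) atTop (𝓝 (1 / (α * lamE))) := by
    intro j _
    have h2 := ((hc 1).const_sub 1).div ((hu.sub (hc j)).mul_const lamE)
      (by rw [sub_zero]; positivity)
    rw [sub_zero, sub_zero] at h2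
    refine h2.congr' ?_
    filter_upwards [eventually_gt_atTop 1] with m hm
    have hm0 : (m : ℝ) ≠ 0 := by positivity
    have hm1 : (m : ℝ) - 1 ≠ 0 := sub_ne_zero.2 (by exact_mod_cast hm.ne')
    rw [Pi.div_apply, one_sub_div hm0, ← sub_div, div_mul_eq_mul_div, div_div_div_cancel_right₀ hm0,
      div_mul_eq_mul_div, one_div_div, mul_comm lamE]
  have h3 := tendsto_finsetSum _ h1
  simp only [Finset.sum_const, Finset.card_range, nsmul_eq_mul, mul_one_div] at h3
  exact h3

/-- The average `k`-keys version age over a graph with `m` nodes, `n` of which are subscribers. -/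
noncomputable def graphAge (k : ℕ) (lamS lamE : ℝ) (m n : ℕ) : ℝ :=
  (n : ℝ) / (m : ℝ) * (lamS * orderStatMean (lamE / ((m : ℝ) - 1)) (n - 1) k) +
    ((m - n : ℕ) : ℝ) / (m : ℝ) * (lamS * orderStatMean (lamE / ((m : ℝ) - 1)) n (k + 1))

lemma hasGraphAge {k m n : ℕ} {lamS lamE : ℝ} (hS : 0 < lamS) (hE : 0 < lamE) (hn : k + 1 ≤ n)
    {Ω : Type*} [MeasurableSpace Ω] {P : Measure Ω} (N : Clocks m lamS lamE P)
    (S : Finset (Fin m)) (hSn : S.card = n) : N.HasGraphAge S k (graphAge k lamS lamE m n) := by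
  have hrate : ∀ j, (S.erase j).Nonempty → 0 < lamE / ((m : ℝ) - 1) := by
    rintro j ⟨i, hi⟩
    have h1 : 1 < Fintype.card (Fin m) :=
      Fintype.one_lt_card_iff.2 ⟨i, j, Finset.ne_of_mem_erase hi⟩
    rw [Fintype.card_fin] at h1
    have : (1 : ℝ) < m := by exact_mod_cast h1
    exact div_pos hE (by linarith)
  refine ⟨lamS * orderStatMean (lamE / ((m : ℝ) - 1)) (n - 1) k,
    lamS * orderStatMean (lamE / ((m : ℝ) - 1)) n (k + 1), fun j hj => ?_, fun j hj => ?_, ?_⟩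
  rotate_left 2
  · rw [Finset.card_compl, Fintype.card_fin, hSn]
    rfl
  · have hcard : (S.erase j).card = n - 1 := by rw [Finset.card_erase_of_mem hj, hSn]
    -- A sole subscriber forces `k = 0`: it decrypts with its own key and has age 0. The edge rate
    -- may be `lamE / 0` here (`m = 1`), so the dummy rate 1 is used.
    rcases (S.erase j).eq_empty_or_nonempty with h | h
    · have hk : k = 0 := by
        rw [h, Finset.card_empty] at hcard
        omega
      have h1 := N.hasVersionAge hS S k j one_pos (fun i => absurd i.2 (by simp [h])) (K := 0)
        (by simp [hj, hk]) (Nat.zero_le _)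
      subst hk
      simpa [orderStatMean] using h1
    · have h1 := N.hasVersionAge hS S k j (hrate j h) (fun _ => rfl) (K := k) (by simp [hj])
        (by omega)
      rwa [hcard] at h1
  · have hcard : (S.erase j).card = n := by rw [Finset.erase_eq_of_notMem hj, hSn]
    have h1 := N.hasVersionAge hS S k j (hrate j (Finset.card_pos.1 (by omega))) (fun _ => rfl)
      (K := k + 1) (by simp [hj]) (by omega)
    rwa [hcard] at h1

/-- The class weights tend to `α` and `1 - α`, and `α k + (1 - α) (k + 1) = k + 1 - α`. Replacing
`n` by `n - 1` for subscribers does not affect the limit. -/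
lemma tendsto_graphAge (k : ℕ) {lamS lamE α : ℝ} (hE : 0 < lamE) (hα0 : 0 < α) (hα1 : α ≤ 1) :
    Tendsto (fun m : ℕ => graphAge k lamS lamE m ⌊α * (m : ℝ)⌋₊) atTop
      (𝓝 (lamS * ((k : ℝ) + 1 - α) / (α * lamE))) := by
  have h1 : Tendsto (fun m : ℕ => (⌊α * (m : ℝ)⌋₊ : ℝ) / m) atTop (𝓝 α) :=
    (tendsto_nat_floor_mul_div_atTop hα0.le).comp tendsto_natCast_atTop_atTop
  have h2 : Tendsto (fun m : ℕ => ((⌊α * (m : ℝ)⌋₊ - 1 : ℕ) : ℝ) / m) atTop (𝓝 α) := by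
    have h3 := h1.sub (tendsto_one_div_atTop_nhds_zero_nat (𝕜 := ℝ))
    rw [sub_zero] at h3
    refine h3.congr' ?_
    have h4 : Tendsto (fun m : ℕ => ⌊α * (m : ℝ)⌋₊) atTop atTop :=
      tendsto_nat_floor_atTop.comp (tendsto_natCast_atTop_atTop.const_mul_atTop hα0)
    filter_upwards [h4.eventually_ge_atTop 1] with m hm
    rw [Nat.cast_sub hm, ← sub_div, Nat.cast_one]
  have h3 : Tendsto (fun m : ℕ => ((m - ⌊α * (m : ℝ)⌋₊ : ℕ) : ℝ) / m) atTop (𝓝 (1 - α)) := by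
    refine (h1.const_sub 1).congr' ?_
    filter_upwards [eventually_gt_atTop 0] with m hm
    have hm0 : (m : ℝ) ≠ 0 := by positivity
    have hle : ⌊α * (m : ℝ)⌋₊ ≤ m := Nat.floor_le_of_le (mul_le_of_le_one_left (by positivity) hα1)
    rw [Nat.cast_sub hle, one_sub_div hm0]
  have h4 := (h1.mul ((tendsto_orderStatMean hE hα0 h2 k).const_mul lamS)).add
    (h3.mul ((tendsto_orderStatMean hE hα0 h1 (k + 1)).const_mul lamS))
  have h5 : lamS * ((k : ℝ) + 1 - α) / (α * lamE) = α * (lamS * (k / (α * lamE))) +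
      (1 - α) * (lamS * ((k + 1 : ℕ) / (α * lamE))) := by
    push_cast
    field_simp
    ring
  rw [h5]
  exact h4

end Limit

end GossipTSS

theorem mainTheorem9 (k : ℕ) (lamS lamE α : ℝ) (hS : 0 < lamS) (hE : 0 < lamE)
    (hα0 : 0 < α) (hα1 : α ≤ 1) :
    ∃ D : ℕ → ℝ,
      (∀ m : ℕ, k + 1 ≤ ⌊α * (m : ℝ)⌋₊ →
        ∀ {Ω : Type*} [MeasurableSpace Ω] (P : Measure Ω) [IsProbabilityMeasure P]
          (N : GossipTSS.Clocks m lamS lamE P) (S : Finset (Fin m)),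
          S.card = ⌊α * (m : ℝ)⌋₊ → N.HasGraphAge S k (D m)) ∧
      Tendsto D atTop (𝓝 (lamS * ((k : ℝ) + 1 - α) / (α * lamE))) :=
  ⟨fun m => GossipTSS.graphAge k lamS lamE m ⌊α * (m : ℝ)⌋₊,
    fun _ hm _ _ _ _ N S hSn => GossipTSS.hasGraphAge hS hE hm N S hSn,
    GossipTSS.tendsto_graphAge k hE hα0 hα1⟩
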